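/- Let $H$ be an infinite-dimensional real separable Hilbert space with orthonormal basis $(v_j)_{j\in\mathbb N}$, and let $C_\mu$, $C$ be symmetric nonnegative trace-class operators with $C_\mu v_j=\mu_jv_j$, $Cv_j=\lambda_jv_j$, where $\mu_j>0$ and $\lambda_j\ge 0$ for all $j$. Let $X_0\sim\mathcal N(0,C_\mu)$, let $\eta(1),\dots,\eta(n)$ be distinct indices, $\mathcal I^{(n)}=\{\eta(1),\dots,\eta(n)\}$, $(Af)_k=\langle v_{\eta(k)},f\rangle$ for $k=1,\dots,n$, and $Y=AX_0+B$ with $B\sim\mathcal N(0,\sigma_B^2I_n)$ independent of $X_0$ and $\sigma_B>0$. Let $T>0$ and let $(X_t)_{t\in[0,T]}$ be the solution of $dX_t=-\frac12X_t\,dt+\sqrt C\,dW_t$ started from $X_0$, with $W$ a (cylindrical) Wiener process on $H$ independent of $(X_0,B)$. For $0<t\le T$ define the conditional score $$S(t,x,y)=-(1-e^{-t})^{-1}\big(x-e^{-t/2}\,\mathbb E[X_0\mid Y=y,X_t=x]\big),$$ where $(x,y)\mapsto\mathbb E[X_0\mid Y=y,X_t=x]$ denotes the continuous version of the conditional expectation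 on $H\times\mathbb R^n$; it exists and is unique. Fix $y\in\mathbb R^n$ and let $Z$ be a solution on $[0,T]$ (with any initial value, on any probability space) of $$dZ_t=\tfrac12Z_t\,dt+S(T-t,Z_t,y)\,dt+\sqrt C\,dW_t,$$ where $W$ now denotes a (cylindrical) Wiener process on $H$ on the space where $Z$ lives. Put $Z^{(j)}=\langle v_j,Z\rangle$, $W^{(j)}=\langle v_j,W\rangle$, $p^{(j)}=\lambda_j/\mu_j$; put $y^{(j)}=y_k$ and $q^{(j)}=\mu_j/\sigma_B^2$ if $j=\eta(k)\in\mathcal I^{(n)}$, and $y^{(j)}=q^{(j)}=0$ if $j\notin\mathcal I^{(n)}$. Then the $W^{(j)}$ are independent and identically distributed standard Brownian motions, and for every $j$, on $[0,T]$, $$dZ^{(j)}_t=\mu^{(x,j)}(T-t)Z^{(j)}_t\,dt+\mu^{(y,j)}(T-t)\,y^{(j)}\,dt+\sqrt{\lambda_j}\,dW^{(j)}_t,$$ with $$\mu^{(x,j)}(t)=\frac12-\frac{e^tp^{(j)}(1+q^{(j)})}{1+(e^t-1)p^{(j)}(1+q^{(j)})},\qquad \mu^{(y,j)}(t)=\frac{e^{t/2}p^{(j)}q^{(j)}}{1+(e^t-1)p^{(j)}(1+q^{(j)})}.$$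 -/

import Mathlib

open MeasureTheory ProbabilityTheory
open scoped NNReal

noncomputable section

/-- `X` is a Gaussian random element with law `N(m, C)`: it is measurable, every continuous linear
functional of it is a real Gaussian variable, its mean is `m` and its covariance operator is `C`. -/
structure IsGaussianElement {Ω E : Type*} [MeasurableSpace Ω]
    [NormedAddCommGroup E] [InnerProductSpace ℝ E] [CompleteSpace E]
    [MeasurableSpace E] [BorelSpace E]
    (X : Ω → E) (m : E) (C : E →L[ℝ] E) (P : Measure Ω) : Prop where
  measurable : Measurable X
  gaussian : HasGaussianLaw X P
  mean : ∫ ω, X ω ∂P = m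
  covariance : ∀ h g : E,
    cov[fun ω => inner ℝ h (X ω), fun ω => inner ℝ g (X ω); P] = inner ℝ (C h) g

/-- `W` is a (cylindrical) Wiener process on the Hilbert space `H`, where `W h t` stands for
`⟨h, W_t⟩`: a centred Gaussian family with `E[⟨h, W_s⟩ ⟨g, W_t⟩] = min s t * ⟨h, g⟩` and with
almost surely continuous trajectories for every `h`. -/
structure IsWienerOn {Ω H : Type*} [MeasurableSpace Ω]
    [NormedAddCommGroup H] [InnerProductSpace ℝ H]
    (W : H → ℝ≥0 → Ω → ℝ) (P : Measure Ω) : Prop where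
  measurable : ∀ h t, Measurable (W h t)
  gaussian : IsGaussianProcess (fun p : H × ℝ≥0 => W p.1 p.2) P
  mean : ∀ h t, ∫ ω, W h t ω ∂P = 0
  covariance : ∀ h g s t, cov[W h s, W g t; P] = min (s : ℝ) (t : ℝ) * inner ℝ h g
  continuous : ∀ h, ∀ᵐ ω ∂P, Continuous (fun t => W h t ω)

/-- `R` is the nonnegative square root of `C`. -/
def IsPositiveSqrt {H : Type*} [NormedAddCommGroup H] [InnerProductSpace ℝ H]
    (R C : H →L[ℝ] H) : Prop :=
  R.IsPositive ∧ R ∘L R = C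

/-- The `H`-valued process `N` is the process `R W`, for a self-adjoint operator `R` and a
cylindrical Wiener process `W`: `⟨h, N_t⟩ = ⟨R h, W_t⟩` almost surely. -/
def IsImageNoise {Ω H : Type*} [MeasurableSpace Ω]
    [NormedAddCommGroup H] [InnerProductSpace ℝ H]
    (R : H →L[ℝ] H) (W : H → ℝ≥0 → Ω → ℝ) (N : ℝ≥0 → Ω → H) (P : Measure Ω) : Prop :=
  ∀ h t, ∀ᵐ ω ∂P, inner ℝ h (N t ω) = W (R h) t ω

/-- The process `Z` solves `dZ_t = b(t, Z_t) dt + dN_t` on `[0, T]`, with no condition on the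
initial value: it has continuous trajectories, the drift is integrable along them, and
`Z_t = Z_0 + ∫_0^t b(s, Z_s) ds + N_t` for all `t ∈ [0, T]`, almost surely. -/
structure IsSDESolution {Ω E : Type*} [MeasurableSpace Ω]
    [NormedAddCommGroup E] [NormedSpace ℝ E] [MeasurableSpace E]
    (b : ℝ → E → E) (N : ℝ≥0 → Ω → E) (T : ℝ≥0) (Z : ℝ≥0 → Ω → E) (P : Measure Ω) : Prop where
  measurable : ∀ t ≤ T, Measurable (Z t)
  continuous : ∀ᵐ ω ∂P, ContinuousOn (fun t => Z t ω) (Set.Iic T)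
  integrable : ∀ᵐ ω ∂P,
    IntervalIntegrable (fun s : ℝ => b s (Z s.toNNReal ω)) volume 0 (T : ℝ)
  equation : ∀ᵐ ω ∂P, ∀ t ≤ T,
    Z t ω = Z 0 ω + (∫ s in (0 : ℝ)..(t : ℝ), b s (Z s.toNNReal ω)) + N t ω

/-- `m` is a continuous version of the regression function `v ↦ E[U | V = v]`, that is, `m` is
continuous and `m(V) = E[U | σ(V)]` almost surely. -/
def IsRegression {Ω E F : Type*} [MeasurableSpace Ω]
    [TopologicalSpace E] [MeasurableSpace E]
    [NormedAddCommGroup F] [NormedSpace ℝ F] [CompleteSpace F]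
    (P : Measure Ω) (U : Ω → F) (V : Ω → E) (m : E → F) : Prop :=
  Continuous m ∧ (fun ω => m (V ω)) =ᵐ[P] P[U | MeasurableSpace.comap V inferInstance]

open Classical in
/-- The function `v ↦ E[U | V = v]`: the continuous version (the value `0` is a placeholder for the
case where there is none). -/
def regression {Ω E F : Type*} [MeasurableSpace Ω]
    [TopologicalSpace E] [MeasurableSpace E]
    [NormedAddCommGroup F] [NormedSpace ℝ F] [CompleteSpace F]
    (P : Measure Ω) (U : Ω → F) (V : Ω → E) : E → F :=
  if h : ∃ m, IsRegression P U V m then h.choose else 0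

/-- The conditional score
`S(t, x, y) = -(1 - e^{-t})⁻¹ (x - e^{-t/2} E[X_0 | Y = y, X_t = x])`. -/
def condScore {Ω H K : Type*} [MeasurableSpace Ω]
    [NormedAddCommGroup H] [InnerProductSpace ℝ H] [CompleteSpace H] [MeasurableSpace H]
    [TopologicalSpace K] [MeasurableSpace K]
    (P : Measure Ω) (X : ℝ≥0 → Ω → H) (Y : Ω → K) (t : ℝ) (x : H) (y : K) : H :=
  -(1 - Real.exp (-t))⁻¹ •
    (x - Real.exp (-t / 2) • regression P (X 0) (fun ω => (X t.toNNReal ω, Y ω)) (x, y))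

/-- `p^{(j)} = λ_j / μ_j`. -/
def modeP (lam mu : ℕ → ℝ) (j : ℕ) : ℝ := lam j / mu j

/-- `q^{(j)} = μ_j / σ_B²` for an observed mode `j`, and `0` otherwise. -/
def modeQ {n : ℕ} (η : Fin n → ℕ) (mu : ℕ → ℝ) (σ : ℝ) (j : ℕ) : ℝ :=
  (Set.range η).indicator (fun i => mu i / σ ^ 2) j

/-- `y^{(j)}`: the observation `y_k` of the mode `j` if `j = η(k)`, and `0` for an unobserved
mode. -/
def modeObs {n : ℕ} (η : Fin n → ℕ) (y : EuclideanSpace ℝ (Fin n)) (j : ℕ) : ℝ :=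
  Function.extend η (fun k => y k) (fun _ => 0) j

/-- The coefficient `μ^{(x)}(t)` for given `p`, `q`. -/
def coeffX (p q t : ℝ) : ℝ :=
  1 / 2 - Real.exp t * p * (1 + q) / (1 + (Real.exp t - 1) * p * (1 + q))

/-- The coefficient `μ^{(y)}(t)` for given `p`, `q`. -/
def coeffY (p q t : ℝ) : ℝ :=
  Real.exp (t / 2) * p * q / (1 + (Real.exp t - 1) * p * (1 + q))

end

/-! By variation of constants `X_t = e^{-t/2} X_0 + M_t`, where `M_t` is `N(0, (1 - e^{-t}) C)` and
independent of `(X_0, B)`. No stochastic integral is needed: pathwise integration by parts exhibits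
`⟨h, M_t⟩` as an almost sure limit of finite sums of Wiener increments, and Gaussian law and
independence pass to the limit through characteristic functions
(`isGaussianElement_ornsteinUhlenbeck`, `indepFun_ornsteinUhlenbeck`).

Hence `X_0`, `X_t`, `Y` form a linear Gaussian model. A linear map `m` is the regression of `X_0` on
`(X_t, Y)` once the residual `X_0 - m(X_t, Y)` is uncorrelated with `(X_t, Y)`, because joint
Gaussianity turns this into independence; the conditions on `m` are the normal equations of
`isRegression_linearGaussianModel`. All operators involved are diagonal in `v`, so these become
scalar equations in each mode, solved by `regressionX` and `regressionY`. These are bounded in `j`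
and so define bounded operators.

The continuous version is unique because `(X_t, Y)` has full support: the support of a centred
Gaussian measure is a closed subspace, and by Hahn–Banach a proper one would be killed by a nonzero
functional. Positivity of all `mu j` and of `σ` excludes this, even when `C` is degenerate.

The score is thus explicit, and its `j`-th coordinate depends on `z` only through `⟨v_j, z⟩`.
Pairing the reverse equation with `v_j`, where the square root of `C` acts as `√λ_j`, gives the
scalar equations. -/

noncomputable section

/-! ### Supports of centred Gaussian measures -/

section Support

variable {E : Type*} [NormedAddCommGroup E] [NormedSpace ℝ E] [CompleteSpace E]
  [SecondCountableTopology E] [MeasurableSpace E] [BorelSpace E] {γ : Measure E} [IsGaussian γ]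

/-- Rotations preserve `γ ⊗ γ`, so the rotated first coordinate again has law `γ`; a product of
neighbourhoods of `a` and `b` has positive mass and is sent into any given neighbourhood of the
combination. -/
lemma cos_smul_add_sin_smul_mem_support (hγ : ∀ L : StrongDual ℝ E, γ[L] = 0) {a b : E}
    (ha : a ∈ γ.support) (hb : b ∈ γ.support) (θ : ℝ) :
    Real.cos θ • a + Real.sin θ • b ∈ γ.support := by
  rw [Measure.support_eq_forall_isOpen] at *
  intro U hU hUo
  have hrot := IsGaussian.map_rotation_eq_self_of_forall_strongDual_eq_zero hγ θ
  have h1 : (γ.prod γ) (U ×ˢ Set.univ) = γ U := by simp [Measure.prod_prod]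
  rw [← h1, ← hrot, Measure.map_apply (by fun_prop) (hUo.measurableSet.prod .univ)]
  have hpre : IsOpen ((fun p : E × E => Real.cos θ • p.1 + Real.sin θ • p.2) ⁻¹' U) :=
    hUo.preimage (by fun_prop)
  obtain ⟨u, v, hu, hv, hau, hbv, huv⟩ := isOpen_prod_iff.1 hpre a b hU
  have hpos : 0 < (γ.prod γ) (u ×ˢ v) := by
    rw [Measure.prod_prod]
    exact ENNReal.mul_pos (ha u hau hu).ne' (hb v hbv hv).ne'
  refine hpos.trans_le (measure_mono fun p hp => ?_)
  simpa [ContinuousLinearMap.rotation_apply] using huv hp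

/-- The support of a centred Gaussian measure is a closed subspace. -/
def gaussianSupport (hγ : ∀ L : StrongDual ℝ E, γ[L] = 0) : Submodule ℝ E :=
  have comb := fun {a b : E} (ha : a ∈ γ.support) (hb : b ∈ γ.support) =>
    cos_smul_add_sin_smul_mem_support hγ ha hb
  -- The angle `π` gives `-a`, and the angle `π / 4` applied to `a` and `-a` gives `0`.
  have zero : (0 : E) ∈ γ.support := by
    obtain ⟨a, ha⟩ := Measure.nonempty_support (IsProbabilityMeasure.ne_zero γ)
    have hna : -a ∈ γ.support := by simpa using comb ha ha Real.pi
    simpa using comb ha hna (Real.pi / 4)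
  have sqrt_two_smul : ∀ a ∈ γ.support, √2 • a ∈ γ.support := fun a ha => by
    have h := comb ha ha (Real.pi / 4)
    rw [Real.cos_pi_div_four, Real.sin_pi_div_four, ← add_smul] at h
    convert! h using 2
    ring
  have pow_smul : ∀ n : ℕ, ∀ a ∈ γ.support, √2 ^ n • a ∈ γ.support := fun n a ha => by
    induction n with
    | zero => simpa using ha
    | succ n ih => simpa [pow_succ', mul_smul] using sqrt_two_smul _ ih
  { carrier := γ.support
    zero_mem' := zero
    add_mem' := fun {a b} ha hb => by
      have h := comb (sqrt_two_smul a ha) (sqrt_two_smul b hb) (Real.pi / 4)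
      have h2 : √2 / 2 * √2 = 1 := by
        rw [div_mul_eq_mul_div, Real.mul_self_sqrt (by norm_num)]; norm_num
      simpa [Real.cos_pi_div_four, Real.sin_pi_div_four, smul_smul, h2] using h
    -- Write `c = √2 ^ n * cos θ` with `n` so large that the arccosine makes sense, and rotate `√2 ^
    -- n • a` against `0`.
    smul_mem' := fun c a ha => by
      obtain ⟨n, hn⟩ := pow_unbounded_of_one_lt |c| Real.one_lt_sqrt_two
      have hpos : 0 < √2 ^ n := by positivity
      have h := comb (pow_smul n a ha) zero (Real.arccos (c / √2 ^ n))
      obtain ⟨h1, h2⟩ := abs_le.1 hn.le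
      rw [Real.cos_arccos (by rwa [le_div_iff₀ hpos, neg_one_mul]) (by rwa [div_le_one hpos]),
        smul_smul, div_mul_cancel₀ _ hpos.ne', smul_zero, add_zero] at h
      exact h }

/-- A centred Gaussian measure has full support if no nonzero continuous linear functional
vanishes almost everywhere. -/
theorem support_eq_univ_of_isGaussian (hγ : ∀ L : StrongDual ℝ E, γ[L] = 0)
    (hinj : ∀ L : StrongDual ℝ E, L =ᵐ[γ] 0 → L = 0) : γ.support = Set.univ := by
  refine Set.eq_univ_of_forall fun x => ?_
  by_contra hx
  obtain ⟨f, u, hfu, hux⟩ := geometric_hahn_banach_closed_point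
    (gaussianSupport hγ).convex Measure.isClosed_support hx
  -- A functional bounded above on a subspace vanishes there: otherwise a multiple of `a` attains
  -- the bound `u`.
  have hf : ∀ a ∈ gaussianSupport hγ, f a = 0 := fun a ha => by
    by_contra h
    have := hfu _ ((gaussianSupport hγ).smul_mem (u / f a) ha)
    simp [div_mul_cancel₀ _ h] at this
  have h0 : f = 0 := hinj f <| by
    filter_upwards [Measure.support_mem_ae (μ := γ)] with a ha using hf a ha
  have := hfu 0 (gaussianSupport hγ).zero_mem
  simp [h0] at this hux
  linarith

end Support

/-! ### Almost sure limits through characteristic functions -/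

section Limits

open Filter Topology

variable {Ω E F : Type*} [MeasurableSpace Ω] {P : Measure Ω} [IsProbabilityMeasure P]
  [NormedAddCommGroup E] [NormedSpace ℝ E] [MeasurableSpace E] [BorelSpace E]
  [SecondCountableTopology E]
  [NormedAddCommGroup F] [NormedSpace ℝ F] [MeasurableSpace F] [BorelSpace F]
  [SecondCountableTopology F]

omit [IsProbabilityMeasure P] [SecondCountableTopology E] in
lemma charFunDual_map_eq_integral {X : Ω → E} (hX : AEMeasurable X P) (L : StrongDual ℝ E) :
    charFunDual (P.map X) L = ∫ ω, Complex.exp (L (X ω) * Complex.I) ∂P := by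
  rw [charFunDual_apply, integral_map hX (by fun_prop)]

lemma tendsto_charFunDual_map {X : ℕ → Ω → E} {Y : Ω → E} (hX : ∀ n, AEMeasurable (X n) P)
    (hY : AEMeasurable Y P) (h : ∀ᵐ ω ∂P, Tendsto (fun n => X n ω) atTop (𝓝 (Y ω)))
    (L : StrongDual ℝ E) :
    Tendsto (fun n => charFunDual (P.map (X n)) L) atTop (𝓝 (charFunDual (P.map Y) L)) := by
  simp_rw [charFunDual_map_eq_integral (hX _), charFunDual_map_eq_integral hY]
  refine tendsto_integral_of_dominated_convergence (fun _ => 1) (fun n => ?_)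
    (integrable_const _) (fun n => ?_) ?_
  · have := hX n
    exact AEMeasurable.aestronglyMeasurable (by fun_prop)
  · simp [Complex.norm_exp_ofReal_mul_I]
  · filter_upwards [h] with ω hω
    have hc : Continuous fun x : E => Complex.exp (L x * Complex.I) := by fun_prop
    exact (hc.tendsto _).comp hω

/-- Independence is preserved by almost sure limits. -/
lemma IndepFun.of_tendsto_ae [CompleteSpace E] [CompleteSpace F] {Q : Ω → E} {X : ℕ → Ω → F}
    {Y : Ω → F} (hQ : AEMeasurable Q P) (hX : ∀ n, AEMeasurable (X n) P) (hY : AEMeasurable Y P)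
    (h : ∀ᵐ ω ∂P, Tendsto (fun n => X n ω) atTop (𝓝 (Y ω))) (hind : ∀ n, IndepFun Q (X n) P) :
    IndepFun Q Y P := by
  rw [indepFun_iff_charFunDual_prod hQ hY]
  intro L
  have h1 := tendsto_charFunDual_map (X := fun n ω => (Q ω, X n ω)) (Y := fun ω => (Q ω, Y ω))
    (fun n => hQ.prodMk (hX n)) (hQ.prodMk hY)
    (by filter_upwards [h] with ω hω using tendsto_const_nhds.prodMk_nhds hω) L
  simp_rw [fun n => (indepFun_iff_charFunDual_prod hQ (hX n)).1 (hind n) L] at h1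
  exact tendsto_nhds_unique h1 ((tendsto_charFunDual_map hX hY h _).const_mul _)

/-- Independence of a Hilbert or Banach valued variable can be tested on its functionals. -/
lemma indepFun_of_forall_strongDual [CompleteSpace E] [CompleteSpace F] {Q : Ω → E} {Y : Ω → F}
    (hQ : AEMeasurable Q P) (hY : AEMeasurable Y P)
    (h : ∀ L : StrongDual ℝ F, IndepFun Q (fun ω => L (Y ω)) P) : IndepFun Q Y P := by
  rw [indepFun_iff_charFunDual_prod hQ hY]
  intro L
  have hLY : AEMeasurable (fun ω => L.comp (.inr ℝ E F) (Y ω)) P := by fun_prop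
  -- The joint characteristic function at `L` sees `Y` only through one scalar functional, so the
  -- scalar case evaluated at the identity of `ℝ` suffices.
  have h1 := (indepFun_iff_charFunDual_prod hQ hLY).1 (h (L.comp (.inr ℝ E F)))
    ((L.comp (.inl ℝ E F)).coprod (.id ℝ ℝ))
  rw [charFunDual_map_eq_integral (by fun_prop), charFunDual_map_eq_integral (by fun_prop),
    charFunDual_map_eq_integral (by fun_prop)] at h1 ⊢
  convert! h1 using 3
  · rename_i ω
    rw [← L.comp_inl_add_comp_inr]
    simp
  · simp
  · simp

/-- An almost sure limit of centred real Gaussian variables with converging variances. -/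
lemma map_eq_gaussianReal_of_tendsto_ae {X : ℕ → Ω → ℝ} {Y : Ω → ℝ} {s : ℕ → ℝ≥0} {r : ℝ≥0}
    (hX : ∀ n, AEMeasurable (X n) P) (hY : AEMeasurable Y P)
    (h : ∀ᵐ ω ∂P, Tendsto (fun n => X n ω) atTop (𝓝 (Y ω)))
    (hlaw : ∀ n, P.map (X n) = gaussianReal 0 (s n)) (hs : Tendsto s atTop (𝓝 r)) :
    P.map Y = gaussianReal 0 r := by
  have := P.isProbabilityMeasure_map hY
  refine Measure.ext_of_charFunDual (funext fun L => ?_)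
  refine tendsto_nhds_unique (tendsto_charFunDual_map hX hY h L) ?_
  have key : ∀ v : ℝ≥0, charFunDual (gaussianReal 0 v) L = Complex.exp (-(v * (L 1) ^ 2 / 2)) := by
    intro v
    obtain ⟨c, hL⟩ : ∃ c, ∀ x : ℝ, L x = c * x := ⟨L 1, fun x => by
      rw [mul_comm, ← smul_eq_mul, ← map_smul]; simp⟩
    have h1 : ∫ x, (L x : ℂ) ∂(gaussianReal 0 v) = 0 := by
      simp_rw [hL]
      rw [integral_complex_ofReal, integral_const_mul, integral_id_gaussianReal]; simp
    have h2 : Var[L; gaussianReal 0 v] = v * c ^ 2 := by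
      rw [show (L : ℝ → ℝ) = fun x => c * id x from funext hL, variance_const_mul,
        variance_id_gaussianReal, mul_comm]
    rw [IsGaussian.charFunDual_eq, h1, h2, hL, mul_one]
    push_cast
    congr 1; ring
  simp_rw [hlaw, key]
  have hc : Continuous fun v : ℝ≥0 => Complex.exp (-((v : ℂ) * (L 1) ^ 2 / 2)) := by fun_prop
  exact (hc.tendsto r).comp hs

end Limits

/-! ### Riemann sums and pathwise integration by parts -/

section RiemannSums

open Filter Topology

/-- Left Riemann sums of `exp (-(t - s))`. -/
lemma tendsto_riemannSum_exp (t : ℝ) (ht : 0 < t) :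
    Tendsto (fun N : ℕ => ∑ k ∈ Finset.range (N + 1),
      Real.exp (-(t - k * (t / (N + 1 : ℕ)))) * (t / (N + 1 : ℕ))) atTop
      (𝓝 (1 - Real.exp (-t))) := by
  have hΔ : Tendsto (fun N : ℕ => t / (N + 1 : ℕ)) atTop (𝓝 0) :=
    (tendsto_const_nhds.div_atTop tendsto_natCast_atTop_atTop).comp (tendsto_add_atTop_nat 1)
  have hpos : ∀ N : ℕ, 0 < t / (N + 1 : ℕ) := fun N => by positivity
  have hΔ' : Tendsto (fun N : ℕ => t / (N + 1 : ℕ)) atTop (𝓝[≠] 0) :=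
    tendsto_nhdsWithin_iff.2 ⟨hΔ, .of_forall fun N => (hpos N).ne'⟩
  -- With mesh `Δ` the geometric sum equals `(1 - e^{-t}) Δ / (e^Δ - 1)`, and the last quotient
  -- tends to `1`, since `exp` has derivative `1` at `0`.
  have hslope := (hasDerivAt_iff_tendsto_slope.1 (Real.hasDerivAt_exp 0)).comp hΔ'
  rw [Real.exp_zero] at hslope
  have h := ((hslope.inv₀ one_ne_zero).const_mul (1 - Real.exp (-t)))
  rw [inv_one, mul_one] at h
  refine h.congr fun N => ?_
  have hN : ((N + 1 : ℕ) : ℝ) * (t / (N + 1 : ℕ)) = t := by field_simp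
  have hgeom : ∀ k : ℕ, Real.exp (-(t - k * (t / (N + 1 : ℕ)))) =
      Real.exp (-t) * Real.exp (t / (N + 1 : ℕ)) ^ k := fun k => by
    rw [← Real.exp_nat_mul, ← Real.exp_add]; ring_nf
  have hne : Real.exp (t / (N + 1 : ℕ)) ≠ 1 := by simpa [Real.exp_eq_one_iff] using (hpos N).ne'
  simp_rw [hgeom, mul_assoc, ← Finset.mul_sum, ← Finset.sum_mul]
  rw [geom_sum_eq hne, ← Real.exp_nat_mul, hN]
  have h2 : Real.exp (-t) * Real.exp t = 1 := by rw [← Real.exp_add]; simp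
  have hne' := sub_ne_zero.2 hne
  simp only [Function.comp, slope, vsub_eq_sub, sub_zero, Real.exp_zero, smul_eq_mul, mul_inv_rev,
    inv_inv]
  linear_combination (-(t / (N + 1 : ℕ)) * (Real.exp (t / (N + 1 : ℕ)) - 1)⁻¹) * h2

/-- For `f(s) = e^{-(t-s)/2}` the drift cancels in the product rule, formally `d(f x) = f dw`. So
the sums differ from a telescoping sum of `f x` only by defects that uniform continuity controls;
`w` need not have bounded variation. -/
lemma tendsto_sum_increments {x w : ℝ → ℝ} {t : ℝ} (ht : 0 < t)
    (hx : ContinuousOn x (Set.Icc 0 t))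
    (hw : ∀ s ∈ Set.Icc 0 t, x s = x 0 + (∫ r in (0 : ℝ)..s, -(1 / 2 : ℝ) * x r) + w s) :
    Tendsto (fun N : ℕ => ∑ k ∈ Finset.range (N + 1),
      Real.exp (-(t - k * (t / (N + 1 : ℕ))) / 2) *
        (w ((k + 1 : ℕ) * (t / (N + 1 : ℕ))) - w (k * (t / (N + 1 : ℕ))))) atTop
      (𝓝 (x t - Real.exp (-t / 2) * x 0)) := by
  set f : ℝ → ℝ := fun s => Real.exp (-(t - s) / 2) with hf
  have hfc : Continuous f := by fun_prop
  have hfd : ∀ s, HasDerivAt f (f s / 2) s := fun s => by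
    have : HasDerivAt (fun s : ℝ => -(t - s) / 2) (1 / 2) s := by
      simpa using (((hasDerivAt_id s).const_sub t).neg).div_const 2
    convert! this.exp using 1
    simp [hf]; ring
  have hint : ∀ a b, a ∈ Set.Icc 0 t → b ∈ Set.Icc 0 t → IntervalIntegrable x volume a b :=
    fun a b ha hb => (hx.mono (Set.uIcc_subset_Icc ha hb)).intervalIntegrable
  -- the defect of the product rule on one interval
  have step : ∀ a ∈ Set.Icc 0 t, ∀ b ∈ Set.Icc 0 t,
      f a * (w b - w a) - (f b * x b - f a * x a) =
        1 / 2 * ∫ s in a..b, (f a * x s - f s * x b) := fun a ha b hb => by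
    have h0 : (0 : ℝ) ∈ Set.Icc 0 t := ⟨le_rfl, ht.le⟩
    have hfi : ∫ s in a..b, f s / 2 = f b - f a :=
      intervalIntegral.integral_eq_sub_of_hasDerivAt (fun s _ => hfd s)
        ((hfc.div_const 2).intervalIntegrable a b)
    have hwab : w b - w a = x b - x a + 1 / 2 * ∫ s in a..b, x s := by
      have e1 := hw a ha
      have e2 := hw b hb
      rw [intervalIntegral.integral_const_mul] at e1 e2
      have e3 := intervalIntegral.integral_add_adjacent_intervals (hint 0 a h0 ha) (hint a b ha hb)
      linear_combination e1 - e2 - (1 / 2 : ℝ) * e3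
    rw [intervalIntegral.integral_sub ((hint a b ha hb).const_mul _)
      ((hfc.intervalIntegrable a b).mul_const _), intervalIntegral.integral_const_mul,
      intervalIntegral.integral_mul_const, hwab]
    rw [intervalIntegral.integral_div] at hfi
    linear_combination (x b) * hfi
  rw [Metric.tendsto_atTop]
  intro ε hε
  -- The defect on `[a, b]` compares this function at `(a, s)` and `(s, b)`. The tolerance `ε / t`
  -- makes the defects add up to at most `ε / 2`.
  have huc : UniformContinuousOn (fun p : ℝ × ℝ => f p.1 * x p.2) (Set.Icc 0 t ×ˢ Set.Icc 0 t) := by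
    refine (isCompact_Icc.prod isCompact_Icc).uniformContinuousOn_of_continuous ?_
    exact (hfc.comp continuous_fst).continuousOn.mul
      (hx.comp continuousOn_snd fun p hp => hp.2)
  obtain ⟨d, hd, hdist⟩ := Metric.uniformContinuousOn_iff.1 huc (ε / t) (by positivity)
  have hΔ : Tendsto (fun N : ℕ => t / (N + 1 : ℕ)) atTop (𝓝 0) :=
    (tendsto_const_nhds.div_atTop tendsto_natCast_atTop_atTop).comp (tendsto_add_atTop_nat 1)
  obtain ⟨N₀, hN₀⟩ := (hΔ.eventually (gt_mem_nhds hd)).exists_forall_of_atTop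
  refine ⟨N₀, fun N hN => ?_⟩
  have hδ := hN₀ N hN
  set δ := t / (N + 1 : ℕ) with hδdef
  have hδpos : 0 < δ := by positivity
  have hNt : ((N + 1 : ℕ) : ℝ) * δ = t := by rw [hδdef]; field_simp
  have hmem : ∀ k ≤ N + 1, (k : ℝ) * δ ∈ Set.Icc 0 t := fun k hk => by
    refine ⟨by positivity, ?_⟩
    rw [← hNt]; gcongr
  have htel : ∑ k ∈ Finset.range (N + 1), (f ((k + 1 : ℕ) * δ) * x ((k + 1 : ℕ) * δ) -
      f (k * δ) * x (k * δ)) = x t - Real.exp (-t / 2) * x 0 := by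
    rw [Finset.sum_range_sub (fun k : ℕ => f (k * δ) * x (k * δ)), hNt]
    simp [hf]
  rw [← htel, Real.dist_eq, ← Finset.sum_sub_distrib]
  have hbound : ∀ k ∈ Finset.range (N + 1), |f (k * δ) * (w ((k + 1 : ℕ) * δ) - w (k * δ)) -
      (f ((k + 1 : ℕ) * δ) * x ((k + 1 : ℕ) * δ) - f (k * δ) * x (k * δ))| ≤
      1 / 2 * (ε / t * δ) := fun k hk => by
    have hk' := Finset.mem_range.1 hk
    have ha := hmem k hk'.le
    have hb := hmem (k + 1) hk'
    have hba : ((k + 1 : ℕ) : ℝ) * δ - k * δ = δ := by push_cast; ring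
    rw [step _ ha _ hb, abs_mul, abs_of_pos (by norm_num : (0 : ℝ) < 1 / 2)]
    gcongr
    refine (intervalIntegral.norm_integral_le_of_norm_le_const (C := ε / t)
      (f := fun s => f (k * δ) * x s - f s * x ((k + 1 : ℕ) * δ)) fun s hs => ?_).trans ?_
    · rw [Set.uIoc_of_le (by linarith)] at hs
      have hs' : s ∈ Set.Icc 0 t := ⟨ha.1.trans hs.1.le, hs.2.trans hb.2⟩
      refine (hdist (k * δ, s) ⟨ha, hs'⟩ (s, (k + 1 : ℕ) * δ) ⟨hs', hb⟩ ?_).le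
      rw [Prod.dist_eq, Real.dist_eq, Real.dist_eq]
      refine max_lt ?_ ?_ <;> rw [abs_sub_lt_iff] <;> constructor <;> linarith [hs.1, hs.2]
    · rw [hba, abs_of_pos hδpos]
  calc _ ≤ _ := Finset.abs_sum_le_sum_abs _ _
    _ ≤ _ := Finset.sum_le_sum hbound
    _ = 1 / 2 * (ε / t * (((N + 1 : ℕ) : ℝ) * δ)) := by simp; ring
    _ = ε / 2 := by rw [hNt]; field_simp
    _ < ε := by linarith

end RiemannSums

/-! ### Gaussian law of weighted Wiener increments -/

section WienerSums

variable {Ω H : Type*} [MeasurableSpace Ω] {P : Measure Ω} [IsProbabilityMeasure P]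
    [NormedAddCommGroup H] [InnerProductSpace ℝ H] {W : H → ℝ≥0 → Ω → ℝ}

lemma IsWienerOn.map_sum_increments (hW : IsWienerOn W P) (h : H) (c : ℕ → ℝ) (δ : ℝ≥0) (N : ℕ) :
    P.map (fun ω => ∑ k ∈ Finset.range N, c k * (W h ((k + 1 : ℕ) * δ) ω - W h (k * δ) ω)) =
      gaussianReal 0 (∑ k ∈ Finset.range N, c k ^ 2 * δ * ‖h‖ ^ 2).toNNReal := by
  have hgp : IsGaussianProcess (fun k ω => c k * (W h ((k + 1 : ℕ) * δ) ω - W h (k * δ) ω)) P := by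
    classical
    refine hW.gaussian.of_isGaussianProcess fun k => ⟨{(h, (k + 1 : ℕ) * δ), (h, k * δ)},
      c k • (.proj ⟨(h, (k + 1 : ℕ) * δ), by simp⟩ - .proj ⟨(h, k * δ), by simp⟩), fun ω => ?_⟩
    simp
  have hL2 : ∀ s, MemLp (W h s) 2 P := fun s => (hW.gaussian.hasGaussianLaw_eval (h, s)).memLp_two
  have hint : ∀ s, Integrable (W h s) P := fun s => (hL2 s).integrable (by norm_num)
  have hincr : ∀ k, MemLp (fun ω => c k * (W h ((k + 1 : ℕ) * δ) ω - W h (k * δ) ω)) 2 P :=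
    fun k => ((hL2 _).sub (hL2 _)).const_mul _
  rw [hgp.hasGaussianLaw_fun_sum.map_eq_gaussianReal]
  congr 1
  · rw [integral_finsetSum]
    · refine Finset.sum_eq_zero fun k _ => ?_
      rw [integral_const_mul, integral_sub (hint _) (hint _), hW.mean, hW.mean]; simp
    · exact fun k _ => ((hint _).sub (hint _)).const_mul _
  · congr 1
    rw [← covariance_self (hgp.hasGaussianLaw_fun_sum.aemeasurable),
      covariance_fun_sum_fun_sum' (fun k _ => hincr k) (fun k _ => hincr k)]
    refine Finset.sum_congr rfl fun k hk => ?_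
    have hcov : ∀ l, cov[fun ω => c k * (W h ((k + 1 : ℕ) * δ) ω - W h (k * δ) ω),
        fun ω => c l * (W h ((l + 1 : ℕ) * δ) ω - W h (l * δ) ω); P] =
        if l = k then c k ^ 2 * δ * ‖h‖ ^ 2 else 0 := fun l => by
      rw [covariance_const_mul_left, covariance_const_mul_right,
        covariance_fun_sub_fun_sub (hL2 _) (hL2 _) (hL2 _) (hL2 _)]
      simp only [hW.covariance, real_inner_self_eq_norm_sq]
      -- All times are multiples of `δ`, so the minima are minima of integers; off the diagonal the
      -- four terms cancel.
      have hmin : ∀ i j : ℕ, min (((i : ℝ≥0) * δ : ℝ≥0) : ℝ) (((j : ℝ≥0) * δ : ℝ≥0) : ℝ) =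
          ((min i j : ℕ) : ℝ) * δ := fun i j => by
        push_cast
        exact (min_mul_of_nonneg _ _ δ.coe_nonneg).symm
      simp only [hmin]
      split_ifs with hlk
      · subst hlk
        simp
        ring
      · rcases lt_or_gt_of_ne hlk with h1 | h1
        · rw [min_eq_right (by omega), min_eq_right (by omega), min_eq_right (by omega),
            min_eq_right (by omega)]
          ring
        · rw [min_eq_left (by omega), min_eq_left (by omega), min_eq_left (by omega),
            min_eq_left (by omega)]
          ring
    simp_rw [hcov, Finset.sum_ite_eq' _ _ _, if_pos hk]

end WienerSums

/-! ### The noise part of the Ornstein–Uhlenbeck process -/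

section OrnsteinUhlenbeck

open Filter Topology

variable {H : Type*} [NormedAddCommGroup H] [InnerProductSpace ℝ H]

lemma IsPositiveSqrt.inner_apply_apply {R C : H →L[ℝ] H} (hR : IsPositiveSqrt R C) (h g : H) :
    inner ℝ (R h) (R g) = inner ℝ (C h) g := by
  rw [← hR.2, ContinuousLinearMap.comp_apply, hR.1.inner_left_eq_inner_right (R h) g]

variable [CompleteSpace H] [SecondCountableTopology H] [MeasurableSpace H] [BorelSpace H]
  {C R : H →L[ℝ] H} {T : ℝ≥0} {Ω : Type*} [MeasurableSpace Ω] {P : Measure Ω}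
  [IsProbabilityMeasure P] {W : H → ℝ≥0 → Ω → ℝ} {N X : ℝ≥0 → Ω → H}

/-- The sums approximating the stochastic integral `∫₀ᵗ e^{-(t-s)/2} d⟨h, W_s⟩`. -/
def wienerSum (W : H → ℝ≥0 → Ω → ℝ) (h : H) (t : ℝ≥0) (n : ℕ) (ω : Ω) : ℝ :=
  ∑ k ∈ Finset.range (n + 1), Real.exp (-((t : ℝ) - k * (t / (n + 1 : ℕ))) / 2) *
    (W h ((k + 1 : ℕ) * (t / (n + 1 : ℕ))) ω - W h (k * (t / (n + 1 : ℕ))) ω)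

omit [CompleteSpace H] [SecondCountableTopology H] [MeasurableSpace H] [BorelSpace H]
  [IsProbabilityMeasure P] in
lemma IsWienerOn.measurable_wienerSum (hW : IsWienerOn W P) (h : H) (t : ℝ≥0) (n : ℕ) :
    Measurable (wienerSum W h t n) :=
  Finset.measurable_fun_sum _ fun _ _ =>
    ((hW.measurable _ _).sub (hW.measurable _ _)).const_mul _

omit [SecondCountableTopology H] [BorelSpace H] [IsProbabilityMeasure P] in
/-- Variation of constants for the Ornstein–Uhlenbeck equation. -/
lemma tendsto_wienerSum_ornsteinUhlenbeck (hN : IsImageNoise R W N P)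
    (hX : IsSDESolution (fun _ x => -(1 / 2 : ℝ) • x) N T X P) {t : ℝ≥0} (ht : 0 < t)
    (htT : t ≤ T) (h : H) :
    ∀ᵐ ω ∂P, Tendsto (fun n => wienerSum W (R h) t n ω) atTop
      (𝓝 (inner ℝ h (X t ω - Real.exp (-t / 2) • X 0 ω))) := by
  have hNW : ∀ᵐ ω ∂P, ∀ n k : ℕ, inner ℝ h (N (k * (t / (n + 1 : ℕ))) ω) =
      W (R h) (k * (t / (n + 1 : ℕ))) ω := by
    rw [ae_all_iff]; intro n; rw [ae_all_iff]; exact fun k => hN h _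
  filter_upwards [hNW, hX.continuous, hX.equation] with ω hω hc heq
  have hXc : ContinuousOn (fun s : ℝ => X s.toNNReal ω) (Set.Icc 0 (t : ℝ)) := by
    refine hc.comp continuous_real_toNNReal.continuousOn fun s hs => ?_
    exact (Real.toNNReal_le_iff_le_coe.2 hs.2).trans htT
  have key := tendsto_sum_increments (x := fun s => inner ℝ h (X s.toNNReal ω))
    (w := fun s => inner ℝ h (N s.toNNReal ω)) (t := t) (by exact_mod_cast ht)
    (continuousOn_const.inner hXc) (fun s hs => by
      have hsT : s.toNNReal ≤ T := (Real.toNNReal_le_iff_le_coe.2 hs.2).trans htT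
      have hint : IntervalIntegrable (fun r : ℝ => -(1 / 2 : ℝ) • X r.toNNReal ω) volume 0 s := by
        refine ContinuousOn.intervalIntegrable ((hXc.mono ?_).const_smul _)
        rw [Set.uIcc_of_le hs.1]
        exact Set.Icc_subset_Icc_right hs.2
      have h1 := heq s.toNNReal hsT
      rw [Real.coe_toNNReal _ hs.1] at h1
      have h2 := (innerSL ℝ h).intervalIntegral_comp_comm hint
      simp only [innerSL_apply_apply, inner_smul_right] at h2
      rw [h1, inner_add_right, inner_add_right, ← h2]
      simp)
  have hcast : ∀ k n : ℕ, ((k : ℝ) * ((t : ℝ) / (n + 1 : ℕ))).toNNReal =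
      (k : ℝ≥0) * (t / (n + 1 : ℕ)) := fun k n => by
    rw [← Real.toNNReal_coe (r := (k : ℝ≥0) * (t / (n + 1 : ℕ)))]
    push_cast
    rfl
  simp only [hcast, hω, Real.toNNReal_coe, Real.toNNReal_zero] at key
  simpa only [wienerSum, inner_sub_right, inner_smul_right] using! key

variable (hR : IsPositiveSqrt R C) (hW : IsWienerOn W P) (hN : IsImageNoise R W N P)
  (hX : IsSDESolution (fun _ x => -(1 / 2 : ℝ) • x) N T X P) {t : ℝ≥0} (ht : 0 < t)
  (htT : t ≤ T)

include hR hW hN hX ht htT in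
-- The approximating sums are centred Gaussian, and their variances are Riemann sums of `e^{-(t-s)}
-- ‖R h‖ ^ 2` over `[0, t]`, where `‖R h‖ ^ 2 = ⟨C h, h⟩`.
lemma map_inner_ornsteinUhlenbeck (h : H) :
    P.map (fun ω => inner ℝ h (X t ω - Real.exp (-t / 2) • X 0 ω)) =
      gaussianReal 0 ((1 - Real.exp (-t)) * inner ℝ (C h) h).toNNReal := by
  have hXm := hX.measurable t htT
  have hX0 := hX.measurable 0 (by simp)
  refine map_eq_gaussianReal_of_tendsto_ae
    (s := fun n => (∑ k ∈ Finset.range (n + 1),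
      Real.exp (-((t : ℝ) - k * (t / (n + 1 : ℕ))) / 2) ^ 2 * (t / (n + 1 : ℕ) : ℝ≥0) *
        ‖R h‖ ^ 2).toNNReal)
    (fun n => (hW.measurable_wienerSum (R h) t n).aemeasurable)
    (by fun_prop) (tendsto_wienerSum_ornsteinUhlenbeck hN hX ht htT h)
    (fun n => hW.map_sum_increments (R h) _ _ _) ?_
  rw [← hR.inner_apply_apply, real_inner_self_eq_norm_sq]
  refine (continuous_real_toNNReal.tendsto _).comp ?_
  refine ((tendsto_riemannSum_exp t (by exact_mod_cast ht)).mul_const (‖R h‖ ^ 2)).congr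
    fun n => ?_
  rw [Finset.sum_mul]
  refine Finset.sum_congr rfl fun k _ => ?_
  rw [← Real.exp_nat_mul]
  push_cast
  ring_nf

include hR hW hN hX ht htT in
/-- The noise part of the Ornstein–Uhlenbeck process is a Gaussian element. -/
lemma isGaussianElement_ornsteinUhlenbeck :
    IsGaussianElement (fun ω => X t ω - Real.exp (-t / 2) • X 0 ω) 0
      ((1 - Real.exp (-t)) • C) P := by
  have hXm := hX.measurable t htT
  have hX0 := hX.measurable 0 (by simp)
  set M := fun ω => X t ω - Real.exp (-t / 2) • X 0 ω with hM
  have hMm : Measurable M := by fun_prop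
  have hlaw : ∀ h, P.map (fun ω => inner ℝ h (M ω)) =
      gaussianReal 0 ((1 - Real.exp (-t)) * inner ℝ (C h) h).toNNReal :=
    map_inner_ornsteinUhlenbeck hR hW hN hX ht htT
  have hgauss : HasGaussianLaw M P := ⟨by
    refine isGaussian_of_isGaussian_map fun L => ?_
    obtain ⟨h, rfl⟩ := (InnerProductSpace.toDual ℝ H).surjective L
    rw [Measure.map_map (by fun_prop) hMm]
    change IsGaussian (P.map fun ω => inner ℝ h (M ω))
    rw [hlaw]
    infer_instance⟩
  have hpos : 0 ≤ 1 - Real.exp (-t) := by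
    simp
  have hvar : ∀ h, Var[fun ω => inner ℝ h (M ω); P] = (1 - Real.exp (-t)) * inner ℝ (C h) h := by
    intro h
    have h1 : Var[id; P.map (fun ω => inner ℝ h (M ω))] = Var[fun ω => inner ℝ h (M ω); P] :=
      variance_map aemeasurable_id (by fun_prop)
    rw [← h1, hlaw, variance_id_gaussianReal, Real.coe_toNNReal]
    refine mul_nonneg hpos ?_
    rw [← hR.inner_apply_apply]
    exact real_inner_self_nonneg
  have hL2 : ∀ h, MemLp (fun ω => inner ℝ h (M ω)) 2 P := fun h =>
    (hgauss.map_fun (innerSL ℝ h)).memLp_two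
  refine ⟨hMm, hgauss, ?_, fun h g => ?_⟩
  · refine ext_inner_left ℝ fun h => ?_
    rw [← integral_inner hgauss.integrable, inner_zero_right]
    have h1 := integral_map (μ := P) (φ := fun ω => inner ℝ h (M ω)) (f := id) (by fun_prop)
      (by fun_prop)
    simp only [hlaw, id, integral_id_gaussianReal] at h1
    exact h1.symm
  -- The covariance follows from the variances by polarisation, `C` being symmetric.
  · have h1 := variance_add (hL2 h) (hL2 g)
    have h2 : (fun ω => inner ℝ h (M ω)) + (fun ω => inner ℝ g (M ω)) =
        fun ω => inner ℝ (h + g) (M ω) := by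
      ext ω; simp [inner_add_left]
    rw [h2, hvar, hvar, hvar] at h1
    have hsymm : inner ℝ (C g) h = inner ℝ (C h) g := by
      rw [← hR.inner_apply_apply, ← hR.inner_apply_apply, real_inner_comm]
    simp only [map_add, inner_add_left, inner_add_right, hsymm] at h1
    simp only [_root_.smul_apply, inner_smul_left, conj_trivial]
    linear_combination -h1 / 2

include hW hN hX ht htT in
lemma indepFun_ornsteinUhlenbeck {E : Type*} [NormedAddCommGroup E] [NormedSpace ℝ E]
    [CompleteSpace E] [MeasurableSpace E] [BorelSpace E] [SecondCountableTopology E] {Q : Ω → E}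
    (hQ : AEMeasurable Q P) (hQW : IndepFun Q (fun ω (p : H × ℝ≥0) => W p.1 p.2 ω) P) :
    IndepFun Q (fun ω => X t ω - Real.exp (-t / 2) • X 0 ω) P := by
  have hXm := hX.measurable t htT
  have hX0 := hX.measurable 0 (by simp)
  refine indepFun_of_forall_strongDual hQ (by fun_prop) fun L => ?_
  obtain ⟨h, rfl⟩ := (InnerProductSpace.toDual ℝ H).surjective L
  refine IndepFun.of_tendsto_ae hQ
    (fun n => (hW.measurable_wienerSum (R h) t n).aemeasurable) (by fun_prop)
    (tendsto_wienerSum_ornsteinUhlenbeck hN hX ht htT h) fun n => ?_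
  -- Each sum is a measurable function of the trajectory of `W`; the one-point type `Unit` replaces
  -- the probability space.
  have hm : Measurable fun w : H × ℝ≥0 → ℝ => wienerSum (fun h s (_ : Unit) => w (h, s)) (R h) t n
      () := by
    unfold wienerSum
    fun_prop
  exact hQW.comp measurable_id hm

end OrnsteinUhlenbeck

/-! ### Continuous versions of conditional expectations -/

section Regression

variable {Ω E F : Type*} [MeasurableSpace Ω] {P : Measure Ω} [IsProbabilityMeasure P]
  [TopologicalSpace E] [MeasurableSpace E] [BorelSpace E] [SecondCountableTopology E]
  [NormedAddCommGroup F] [NormedSpace ℝ F] [CompleteSpace F] [MeasurableSpace F] [BorelSpace F]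
  [SecondCountableTopology F] {U : Ω → F} {V : Ω → E}

omit [SecondCountableTopology E] in
/-- If the residual `U - m(V)` is centred and independent of `V`, then `m` is the regression
function. -/
lemma isRegression_of_indepFun {m : E → F} (hm : Continuous m) (hU : Measurable U)
    (hV : Measurable V) (hUi : Integrable U P) (hri : Integrable (fun ω => U ω - m (V ω)) P)
    (hr0 : ∫ ω, (U ω - m (V ω)) ∂P = 0) (hind : IndepFun (fun ω => U ω - m (V ω)) V P) :
    IsRegression P U V m := by
  refine ⟨hm, ?_⟩
  have hmV : Measurable (fun ω => m (V ω)) := hm.measurable.comp hV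
  have hmVi : Integrable (fun ω => m (V ω)) P := by
    simpa [Pi.sub_def] using hUi.sub hri
  have hres : Measurable (fun ω => U ω - m (V ω)) := hU.sub hmV
  have h1 : P[fun ω => U ω - m (V ω) | MeasurableSpace.comap V inferInstance] =ᵐ[P]
      fun _ => (0 : F) := by
    have := condExp_indep_eq (μ := P) (f := fun ω => U ω - m (V ω))
      (m₁ := MeasurableSpace.comap (fun ω => U ω - m (V ω)) inferInstance)
      hres.comap_le hV.comap_le (comap_measurable _).stronglyMeasurable hind
    rwa [hr0] at this
  have h2 : P[fun ω => m (V ω) | MeasurableSpace.comap V inferInstance] = fun ω => m (V ω) :=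
    condExp_of_stronglyMeasurable hV.comap_le
      (hm.measurable.comp (comap_measurable V)).stronglyMeasurable hmVi
  have h3 := condExp_add hri hmVi (MeasurableSpace.comap V inferInstance)
  have h4 : (fun ω => U ω - m (V ω)) + (fun ω => m (V ω)) = U := by ext ω; simp
  rw [h4, h2] at h3
  filter_upwards [h1, h3] with ω e1 e3
  rw [e3, Pi.add_apply, e1, zero_add]

omit [IsProbabilityMeasure P] [MeasurableSpace F] [BorelSpace F] [SecondCountableTopology F]
  [SecondCountableTopology E] in
/-- The continuous version is unique when the law of `V` has full support. -/
lemma IsRegression.eq_of_support_eq_univ (hV : Measurable V)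
    (hsupp : (P.map V).support = Set.univ) {m₁ m₂ : E → F}
    (h₁ : IsRegression P U V m₁) (h₂ : IsRegression P U V m₂) : m₁ = m₂ := by
  -- The set of agreement is closed and has full measure, so it contains the support.
  have hcl : IsClosed {x | m₁ x = m₂ x} := isClosed_eq h₁.1 h₂.1
  have hae : {x | m₁ x = m₂ x} ∈ ae (P.map V) := by
    refine (ae_map_iff hV.aemeasurable hcl.measurableSet).2 ?_
    filter_upwards [h₁.2, h₂.2] with ω e1 e2 using e1.trans e2.symm
  have := Measure.support_subset_of_isClosed hcl hae
  rw [hsupp] at this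
  exact funext fun x => this (Set.mem_univ x)

omit [IsProbabilityMeasure P] [MeasurableSpace F] [BorelSpace F] [SecondCountableTopology F]
  [BorelSpace E] [SecondCountableTopology E] in
lemma regression_eq_of_unique {m : E → F} (hm : IsRegression P U V m)
    (huniq : ∀ m', IsRegression P U V m' → m' = m) : regression P U V = m := by
  have h : ∃ m, IsRegression P U V m := ⟨m, hm⟩
  rw [regression, dif_pos h]
  exact huniq _ h.choose_spec

end Regression

/-! ### Regression in a linear Gaussian model -/

section LinearGaussianModel

variable {Ω H K : Type*} [MeasurableSpace Ω] {P : Measure Ω} [IsProbabilityMeasure P]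
  [NormedAddCommGroup H] [InnerProductSpace ℝ H] [CompleteSpace H] [SecondCountableTopology H]
  [MeasurableSpace H] [BorelSpace H]
  [NormedAddCommGroup K] [InnerProductSpace ℝ K] [CompleteSpace K] [SecondCountableTopology K]
  [MeasurableSpace K] [BorelSpace K]
  {U M : Ω → H} {B : Ω → K} {Q D : H →L[ℝ] H} {S : K →L[ℝ] K}

omit [IsProbabilityMeasure P] [SecondCountableTopology H] in
lemma IsGaussianElement.memLp_inner (hU : IsGaussianElement U 0 Q P) (h : H) :
    MemLp (fun ω => inner ℝ h (U ω)) 2 P :=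
  (hU.gaussian.map_fun (innerSL ℝ h)).memLp_two

omit [IsProbabilityMeasure P] in
lemma IsGaussianElement.integral_inner (hU : IsGaussianElement U 0 Q P) (h : H) :
    ∫ ω, inner ℝ h (U ω) ∂P = 0 := by
  rw [_root_.integral_inner hU.gaussian.integrable, hU.mean, inner_zero_right]

omit [IsProbabilityMeasure P] [SecondCountableTopology H] in
lemma IsGaussianElement.inner_nonneg (hU : IsGaussianElement U 0 Q P) (h : H) :
    0 ≤ inner ℝ (Q h) h := by
  have := hU.measurable
  rw [← hU.covariance, covariance_self (by fun_prop)]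
  exact variance_nonneg _ _

variable (hU : IsGaussianElement U 0 Q P) (hB : IsGaussianElement B 0 S P)
  (hM : IsGaussianElement M 0 D P) (hUB : IndepFun U B P)
  (hUBM : IndepFun (fun ω => (U ω, B ω)) M P)

include hU hB hM hUB hUBM in
/-- Covariance of linear functionals of three independent centred Gaussian elements. -/
lemma covariance_inner_add_inner_add_inner (a a' c c' : H) (b b' : K) :
    cov[fun ω => inner ℝ a (U ω) + inner ℝ b (B ω) + inner ℝ c (M ω),
      fun ω => inner ℝ a' (U ω) + inner ℝ b' (B ω) + inner ℝ c' (M ω); P] =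
      inner ℝ (Q a) a' + inner ℝ (S b) b' + inner ℝ (D c) c' := by
  have hUM : IndepFun U M P := hUBM.comp measurable_fst measurable_id
  have hBM : IndepFun B M P := hUBM.comp measurable_snd measurable_id
  have cUB : ∀ a b, cov[fun ω => inner ℝ a (U ω), fun ω => inner ℝ b (B ω); P] = 0 := fun a b =>
    (hUB.comp (φ := fun x => inner ℝ a x) (ψ := fun x => inner ℝ b x) (by fun_prop)
      (by fun_prop)).covariance_eq_zero (hU.memLp_inner a) (hB.memLp_inner b)
  have cUM : ∀ a b, cov[fun ω => inner ℝ a (U ω), fun ω => inner ℝ b (M ω); P] = 0 := fun a b =>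
    (hUM.comp (φ := fun x => inner ℝ a x) (ψ := fun x => inner ℝ b x) (by fun_prop)
      (by fun_prop)).covariance_eq_zero (hU.memLp_inner a) (hM.memLp_inner b)
  have cBM : ∀ a b, cov[fun ω => inner ℝ a (B ω), fun ω => inner ℝ b (M ω); P] = 0 := fun a b =>
    (hBM.comp (φ := fun x => inner ℝ a x) (ψ := fun x => inner ℝ b x) (by fun_prop)
      (by fun_prop)).covariance_eq_zero (hB.memLp_inner a) (hM.memLp_inner b)
  change cov[(fun ω => inner ℝ a (U ω)) + (fun ω => inner ℝ b (B ω)) + fun ω => inner ℝ c (M ω),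
    (fun ω => inner ℝ a' (U ω)) + (fun ω => inner ℝ b' (B ω)) + fun ω => inner ℝ c' (M ω); P] = _
  have lU := hU.memLp_inner
  have lB := hB.memLp_inner
  have lM := hM.memLp_inner
  have l' := ((lU a').add (lB b')).add (lM c')
  rw [covariance_add_left ((lU a).add (lB b)) (lM c) l', covariance_add_left (lU a) (lB b) l']
  simp only [covariance_add_right (lU _) ((lU a').add (lB b')) (lM c'),
    covariance_add_right (lB _) ((lU a').add (lB b')) (lM c'),
    covariance_add_right (lM _) ((lU a').add (lB b')) (lM c'),
    covariance_add_right (lU _) (lU a') (lB b'), covariance_add_right (lB _) (lU a') (lB b'),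
    covariance_add_right (lM _) (lU a') (lB b'), hU.covariance, hB.covariance, hM.covariance,
    cUB, cUM, cBM]
  rw [covariance_comm, cUB, covariance_comm, cUM, covariance_comm, cBM]
  ring

omit [IsProbabilityMeasure P] in
include hU hB hM in
lemma integral_inner_add_inner_add_inner (a c : H) (b : K) :
    ∫ ω, (inner ℝ a (U ω) + inner ℝ b (B ω) + inner ℝ c (M ω)) ∂P = 0 := by
  have := hU.gaussian.isProbabilityMeasure
  have iU := (hU.memLp_inner a).integrable one_le_two
  have iB := (hB.memLp_inner b).integrable one_le_two
  have iM := (hM.memLp_inner c).integrable one_le_two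
  have h1 : ∫ ω, (inner ℝ a (U ω) + inner ℝ b (B ω)) ∂P = 0 := by
    rw [integral_add iU iB, hU.integral_inner, hB.integral_inner, add_zero]
  have h2 := integral_add (iU.add iB) iM
  simp only [Pi.add_apply] at h2
  rw [h2, h1, hM.integral_inner, add_zero]

variable (e : ℝ) (A : H →L[ℝ] K)

omit [IsProbabilityMeasure P] in
include hU hB hM hUB hUBM in
lemma hasGaussianLaw_triple : HasGaussianLaw (fun ω => ((U ω, B ω), M ω)) P :=
  hUBM.hasGaussianLaw (hUB.hasGaussianLaw hU.gaussian hB.gaussian) hM.gaussian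

include hU hB hM hUB hUBM in
/-- The law of `(e U + M, A U + B)` has full support. -/
lemma support_map_linearGaussianModel (he : e ≠ 0)
    (hQ : ∀ g, inner ℝ (Q g) g = 0 → g = 0) (hS : ∀ z, inner ℝ (S z) z = 0 → z = 0) :
    (P.map fun ω => (e • U ω + M ω, A (U ω) + B ω)).support = Set.univ := by
  let Φ : (H × K) × H →L[ℝ] H × K :=
    (e • (ContinuousLinearMap.fst ℝ H K).comp (.fst ℝ (H × K) H) + .snd ℝ (H × K) H).prod
      ((A.comp (.fst ℝ H K) + .snd ℝ H K).comp (.fst ℝ (H × K) H))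
  have hV : HasGaussianLaw (fun ω => (e • U ω + M ω, A (U ω) + B ω)) P :=
    (hasGaussianLaw_triple hU hB hM hUB hUBM).map_fun Φ
  have := hV.isGaussian_map
  have hUm := hU.measurable
  have hBm := hB.measurable
  have hMm := hM.measurable
  have hVm : Measurable (fun ω => (e • U ω + M ω, A (U ω) + B ω)) := by fun_prop
  have hrep : ∀ L : StrongDual ℝ (H × K), ∃ g z, (∀ x y, L (x, y) = inner ℝ g x + inner ℝ z y) ∧
      ∀ ω, L (e • U ω + M ω, A (U ω) + B ω) =
      inner ℝ (e • g + A.adjoint z) (U ω) + inner ℝ z (B ω) + inner ℝ g (M ω) := fun L => by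
    obtain ⟨g, hg⟩ := (InnerProductSpace.toDual ℝ H).surjective (L.comp (.inl ℝ H K))
    obtain ⟨z, hz⟩ := (InnerProductSpace.toDual ℝ K).surjective (L.comp (.inr ℝ H K))
    have h1 : ∀ x y, L (x, y) = inner ℝ g x + inner ℝ z y := fun x y => by
      rw [← L.comp_inl_add_comp_inr, ← hg, ← hz]
      rfl
    refine ⟨g, z, h1, fun ω => ?_⟩
    rw [h1, inner_add_right, inner_add_right, inner_add_left, inner_smul_left, inner_smul_right,
      ContinuousLinearMap.adjoint_inner_left]
    simp; ring
  refine support_eq_univ_of_isGaussian (fun L => ?_) fun L hL => ?_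
  · obtain ⟨g, z, -, h⟩ := hrep L
    rw [integral_map hVm.aemeasurable (by fun_prop)]
    simp_rw [h]
    exact integral_inner_add_inner_add_inner hU hB hM _ _ _
  · obtain ⟨g, z, h1, h⟩ := hrep L
    have h0 : (fun ω => inner ℝ (e • g + A.adjoint z) (U ω) + inner ℝ z (B ω) + inner ℝ g (M ω))
        =ᵐ[P] 0 := by
      filter_upwards [ae_of_ae_map hVm.aemeasurable hL] with ω hω
      rw [← h]; exact hω
    have hcov := covariance_inner_add_inner_add_inner hU hB hM hUB hUBM (e • g + A.adjoint z)
      (e • g + A.adjoint z) g g z z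
    rw [covariance_self (by fun_prop), variance_congr h0, variance_zero] at hcov
    -- A vanishing sum of three nonnegative variances: nondegeneracy of `S` gives `z = 0`, then that
    -- of `Q` gives `e • g = 0`. Only nonnegativity of `D` is needed.
    have p1 := hU.inner_nonneg (e • g + A.adjoint z)
    have p2 := hB.inner_nonneg z
    have p3 := hM.inner_nonneg g
    have hz : z = 0 := hS z (by linarith)
    have hg : e • g + A.adjoint z = 0 := hQ _ (by linarith)
    have hg' : g = 0 := by simpa [hz, he] using hg
    ext x <;> simp [h1, hz, hg']

include hU hB hM hUB hUBM in
/-- The regression of `U` on `(e U + M, A U + B)`, from the normal equations. -/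
lemma isRegression_linearGaussianModel {G J : H →L[ℝ] H} (hG : G.IsSymmetric) (hJ : J.IsSymmetric)
    (h₁ : ∀ h, e • Q (h - e • G h - A.adjoint (A (J h))) = D (G h))
    (h₂ : ∀ h, A (Q (h - e • G h - A.adjoint (A (J h)))) = S (A (J h))) :
    IsRegression P U (fun ω => (e • U ω + M ω, A (U ω) + B ω))
      (fun p => G p.1 + J (A.adjoint p.2)) := by
  let Φ : (H × K) × H →L[ℝ] H × K :=
    (e • (ContinuousLinearMap.fst ℝ H K).comp (.fst ℝ (H × K) H) + .snd ℝ (H × K) H).prod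
      ((A.comp (.fst ℝ H K) + .snd ℝ H K).comp (.fst ℝ (H × K) H))
  let m : H × K →L[ℝ] H := G.comp (.fst ℝ H K) + (J.comp A.adjoint).comp (.snd ℝ H K)
  let Ψ : (H × K) × H →L[ℝ] H := (ContinuousLinearMap.fst ℝ H K).comp (.fst ℝ (H × K) H) - m.comp Φ
  have hjoint : HasGaussianLaw (fun ω => (U ω - (G (e • U ω + M ω) + J (A.adjoint (A (U ω) + B ω))),
      (e • U ω + M ω, A (U ω) + B ω))) P :=
    (hasGaussianLaw_triple hU hB hM hUB hUBM).map_fun (Ψ.prod Φ)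
  have hUm := hU.measurable
  have hBm := hB.measurable
  have hMm := hM.measurable
  have hinner : ∀ h ω, inner ℝ h (U ω - (G (e • U ω + M ω) + J (A.adjoint (A (U ω) + B ω)))) =
      inner ℝ (h - e • G h - A.adjoint (A (J h))) (U ω) + inner ℝ (-A (J h)) (B ω) +
        inner ℝ (-G h) (M ω) := fun h ω => by
    have e1 : ∀ x, inner ℝ h (G x) = inner ℝ (G h) x := fun x => (hG h x).symm
    have e2 : ∀ x, inner ℝ h (J x) = inner ℝ (J h) x := fun x => (hJ h x).symm
    simp only [inner_sub_right, inner_add_right, e1, e2, ContinuousLinearMap.adjoint_inner_right,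
      inner_sub_left, ContinuousLinearMap.adjoint_inner_left, inner_neg_left, inner_smul_left,
      inner_smul_right, conj_trivial]
    ring
  refine isRegression_of_indepFun (by fun_prop) hUm (by fun_prop) hU.gaussian.integrable
    hjoint.fst.integrable ?_ (hjoint.indepFun_of_covariance_strongDual fun L₁ L₂ => ?_)
  · refine ext_inner_left ℝ fun h => ?_
    rw [← _root_.integral_inner hjoint.fst.integrable, inner_zero_right]
    simp_rw [hinner]
    exact integral_inner_add_inner_add_inner hU hB hM _ _ _
  · obtain ⟨h, rfl⟩ := (InnerProductSpace.toDual ℝ H).surjective L₁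
    obtain ⟨g, hg⟩ := (InnerProductSpace.toDual ℝ H).surjective (L₂.comp (.inl ℝ H K))
    obtain ⟨z, hz⟩ := (InnerProductSpace.toDual ℝ K).surjective (L₂.comp (.inr ℝ H K))
    have hL : ∀ ω, L₂ (e • U ω + M ω, A (U ω) + B ω) =
        inner ℝ (e • g + A.adjoint z) (U ω) + inner ℝ z (B ω) + inner ℝ g (M ω) := fun ω => by
      rw [← L₂.comp_inl_add_comp_inr, ← hg, ← hz]
      simp only [InnerProductSpace.toDual_apply_apply]
      rw [inner_add_right, inner_add_right, inner_add_left, inner_smul_left, inner_smul_right,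
        ContinuousLinearMap.adjoint_inner_left]
      simp; ring
    simp only [Function.comp_def, InnerProductSpace.toDual_apply_apply, hinner, hL]
    rw [covariance_inner_add_inner_add_inner hU hB hM hUB hUBM]
    -- The covariance of the residual with `L₂` is the first normal equation paired with `g` plus
    -- the second paired with `z`.
    have e1 := congrArg (fun x => inner ℝ x g) (h₁ h)
    have e2 := congrArg (fun x => inner ℝ x z) (h₂ h)
    simp only [inner_smul_left, conj_trivial] at e1
    rw [inner_add_right, inner_smul_right, ContinuousLinearMap.adjoint_inner_right, map_neg,
      map_neg, inner_neg_left, inner_neg_left]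
    linear_combination e1 + e2

end LinearGaussianModel

/-! ### Operators diagonal in a Hilbert basis -/

section Diagonal

variable {H : Type*} [NormedAddCommGroup H] [InnerProductSpace ℝ H] [CompleteSpace H]

/-- Every bounded sequence is the sequence of eigenvalues of a symmetric bounded operator. -/
lemma HilbertBasis.exists_isSymmetric_apply_eq_smul {ι : Type*} (v : HilbertBasis ι ℝ H)
    (a : ι → ℝ) {c : ℝ} (ha : ∀ j, |a j| ≤ c) :
    ∃ G : H →L[ℝ] H, G.IsSymmetric ∧ ∀ j, G (v j) = a j • v j := by
  have hmem : ∀ x : H, Memℓp (fun j => a j * v.repr x j) 2 := fun x => by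
    refine memℓp_gen ?_
    have h := (lp.memℓp (v.repr x)).summable (by norm_num)
    refine .of_nonneg_of_le (fun j => by positivity) (fun j => ?_)
      (h.mul_left (c ^ (2 : ENNReal).toReal))
    have hc : 0 ≤ c := (abs_nonneg _).trans (ha j)
    rw [norm_mul, Real.mul_rpow (norm_nonneg _) (norm_nonneg _)]
    gcongr
    exact ha j
  let T : H →ₗ[ℝ] H :=
    { toFun := fun x => v.repr.symm ⟨fun j => a j * v.repr x j, hmem x⟩
      map_add' := fun x y => by
        rw [← map_add]
        congr 1
        ext j
        change a j * v.repr (x + y) j = a j * v.repr x j + a j * v.repr y j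
        simp [mul_add]
      map_smul' := fun r x => by
        rw [← map_smul]
        congr 1
        ext j
        simp; ring }
  have hT : ∀ x j, inner ℝ (v j) (T x) = a j * inner ℝ (v j) x := fun x j => by
    rw [← v.repr_apply_apply, ← v.repr_apply_apply]
    simp [T]
  have hsymm : T.IsSymmetric := fun x y => by
    rw [← v.tsum_inner_mul_inner, ← v.tsum_inner_mul_inner]
    refine tsum_congr fun j => ?_
    rw [hT, real_inner_comm, hT, real_inner_comm (v j) x]
    ring
  -- Continuity is the Hellinger–Toeplitz theorem: `T` is symmetric and defined everywhere.
  refine ⟨⟨T, hsymm.continuous⟩, hsymm, fun j => ?_⟩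
  refine v.repr.injective (lp.ext (funext fun i => ?_))
  rw [v.repr_apply_apply]
  change inner ℝ (v i) (T (v j)) = _
  rw [hT, map_smul, lp.coeFn_smul, Pi.smul_apply, v.repr_apply_apply, smul_eq_mul]
  by_cases hij : i = j
  · rw [hij]
  · simp [v.orthonormal.2 hij]

omit [CompleteSpace H] in
lemma HilbertBasis.clm_ext {ι F : Type*} [NormedAddCommGroup F] [NormedSpace ℝ F]
    (v : HilbertBasis ι ℝ H) {S T : H →L[ℝ] F} (h : ∀ j, S (v j) = T (v j)) : S = T :=
  ContinuousLinearMap.ext_on (s := Set.range v)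
    (by rw [Submodule.dense_iff_topologicalClosure_eq_top]; exact v.dense_span)
    (by rintro _ ⟨j, rfl⟩; exact h j)

omit [CompleteSpace H] in
-- By Parseval `⟨Q g, g⟩ = ∑ mu j * ⟨v_j, g⟩ ^ 2`, with strictly positive weights.
lemma HilbertBasis.eq_zero_of_inner_apply_self_eq_zero {ι : Type*} (v : HilbertBasis ι ℝ H)
    {Q : H →L[ℝ] H} {mu : ι → ℝ} (hQ : Q.IsSymmetric) (hQv : ∀ j, Q (v j) = mu j • v j)
    (hmu : ∀ j, 0 < mu j) {g : H} (hg : inner ℝ (Q g) g = 0) : g = 0 := by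
  have h := v.hasSum_inner_mul_inner (Q g) g
  rw [hg] at h
  have hterm : ∀ j, inner ℝ (Q g) (v j) * inner ℝ (v j) g = mu j * inner ℝ (v j) g ^ 2 := fun j => by
    have : inner ℝ (Q g) (v j) = inner ℝ g (Q (v j)) := hQ g (v j)
    rw [this, hQv, inner_smul_right, real_inner_comm]
    ring
  simp_rw [hterm] at h
  have h0 := (hasSum_zero_iff_of_nonneg fun j => mul_nonneg (hmu j).le (sq_nonneg _)).1 h
  refine v.repr.injective (lp.ext (funext fun j => ?_))
  have := congrFun h0 j
  simp only [Pi.zero_apply, mul_eq_zero, (hmu j).ne', false_or, pow_eq_zero_iff, ne_eq,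
    OfNat.ofNat_ne_zero, not_false_eq_true] at this
  rw [v.repr_apply_apply, this]
  simp

end Diagonal

/-! ### Projection of the noise and of the equation to a mode -/

section Modes

variable {H : Type*} [NormedAddCommGroup H] [InnerProductSpace ℝ H]

/-- Since `(R + √l)(R - √l) x = 0`, the vector `u = (R - √l) x` satisfies `R u = -√l u`, which
positivity of `R` forbids unless `u = 0` or `l = 0`; in the latter case `‖R x‖ ^ 2 = ⟨C x, x⟩ = 0`.
-/
lemma IsPositiveSqrt.apply_eigenvector {R C : H →L[ℝ] H} (hR : IsPositiveSqrt R C) {l : ℝ}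
    (hl : 0 ≤ l) {x : H} (hx : C x = l • x) : R x = √l • x := by
  rw [← sub_eq_zero]
  set u := R x - √l • x with hu
  have hRR : R (R x) = l • x := by
    rw [← hx, ← hR.2, ContinuousLinearMap.comp_apply]
  have hRu : R u = -√l • u := by
    rw [hu, map_sub, map_smul, hRR, smul_sub, smul_smul, neg_mul, Real.mul_self_sqrt hl]
    module
  have hpos := hR.1.inner_nonneg_left u
  rw [hRu, inner_smul_left, real_inner_self_eq_norm_sq] at hpos
  simp only [conj_trivial, neg_mul, Left.nonneg_neg_iff] at hpos
  rcases (Real.sqrt_nonneg l).eq_or_lt with h0 | h0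
  · have h := hR.inner_apply_apply x x
    have hl0 : l = 0 := (Real.sqrt_eq_zero hl).1 h0.symm
    rw [hx, hl0, zero_smul, inner_zero_left, inner_self_eq_zero] at h
    rw [hu, h, ← h0]
    simp
  · have : ‖u‖ ^ 2 ≤ 0 := by nlinarith
    simpa using this

variable {Ω : Type*} [MeasurableSpace Ω] {P : Measure Ω} [IsProbabilityMeasure P]
  {W : H → ℝ≥0 → Ω → ℝ}

/-- Linearity in `h` is not part of the definition of `W`; the covariance forces it, as the
difference is centred with variance zero. -/
lemma IsWienerOn.smul_ae_eq (hW : IsWienerOn W P) (c : ℝ) (h : H) (t : ℝ≥0) :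
    ∀ᵐ ω ∂P, W (c • h) t ω = c * W h t ω := by
  have hL2 : ∀ g, MemLp (W g t) 2 P := fun g => (hW.gaussian.hasGaussianLaw_eval (g, t)).memLp_two
  have hL2c : MemLp (fun ω => c * W h t ω) 2 P := (hL2 h).const_mul c
  have hvar : Var[fun ω => W (c • h) t ω - c * W h t ω; P] = 0 := by
    rw [variance_fun_sub (hL2 _) hL2c, variance_const_mul, covariance_const_mul_right,
      ← covariance_self (hL2 _).aemeasurable, ← covariance_self (hL2 _).aemeasurable]
    simp only [hW.covariance, inner_smul_left, inner_smul_right, conj_trivial]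
    ring
  have hmean : ∫ ω, (W (c • h) t ω - c * W h t ω) ∂P = 0 := by
    rw [integral_sub ((hL2 _).integrable one_le_two) (hL2c.integrable one_le_two),
      integral_const_mul, hW.mean, hW.mean]
    simp
  filter_upwards [ae_eq_integral_of_variance_eq_zero ((hL2 (c • h)).sub hL2c) hvar] with ω hω
  simp only [Pi.sub_apply, hmean] at hω
  exact sub_eq_zero.1 hω

omit [IsProbabilityMeasure P] in
lemma IsWienerOn.isBrownianReal (hW : IsWienerOn W P) {h : H} (hh : ‖h‖ = 1) :
    IsBrownianReal (W h) P where
  toIsPreBrownianReal := by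
    have hg : IsGaussianProcess (W h) P := hW.gaussian.comp_right fun t => (h, t)
    refine hg.isPreBrownianReal_of_covariance (hW.mean h) fun s t hst => ?_
    rw [hW.covariance, real_inner_self_eq_norm_sq, hh, min_eq_left (by exact_mod_cast hst)]
    simp
  cont := hW.continuous h

omit [IsProbabilityMeasure P] in
lemma IsWienerOn.iIndepFun_of_orthonormal (hW : IsWienerOn W P) {ι : Type*} {v : ι → H}
    (hv : Orthonormal ℝ v) : iIndepFun (fun j ω (t : ℝ≥0) => W (v j) t ω) P := by
  have hg : IsGaussianProcess (fun (p : (_ : ι) × ℝ≥0) ω => W (v p.1) p.2 ω) P :=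
    hW.gaussian.comp_right fun p : (_ : ι) × ℝ≥0 => (v p.1, p.2)
  refine IsGaussianProcess.iIndepFun_of_covariance_eq_zero (X := fun j t ω => W (v j) t ω) hg
    (fun j t => (hW.measurable _ _).aemeasurable) fun i j hij s t => ?_
  have := hW.covariance (v i) (v j) s t
  rw [hv.2 hij, mul_zero] at this
  exact this

variable [CompleteSpace H] [MeasurableSpace H]

omit [CompleteSpace H] in
/-- The noise of a mode, simultaneously for all times. -/
lemma ae_forall_inner_noise_eq {R : H →L[ℝ] H} {N Z : ℝ≥0 → Ω → H} {b : ℝ → H → H} {T : ℝ≥0}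
    (hW : IsWienerOn W P) (hN : IsImageNoise R W N P) (hZ : IsSDESolution b N T Z P) {h : H}
    {c : ℝ} (hR : R h = c • h) :
    ∀ᵐ ω ∂P, ∀ t ≤ T, inner ℝ h (N t ω) = c * W h t ω := by
  obtain ⟨D, hDc, hDd⟩ := TopologicalSpace.exists_countable_dense (Set.Iic T)
  -- The null set depends on `t`, so the identity is first obtained on a countable dense set; the
  -- equation itself then shows that `N` is continuous on `[0, T]`.
  have hD : ∀ᵐ ω ∂P, ∀ t ∈ D, inner ℝ h (N t ω) = c * W h t ω := by
    rw [ae_ball_iff hDc]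
    intro t _
    filter_upwards [hN h t, hW.smul_ae_eq c h t] with ω h1 h2
    rw [h1, hR, h2]
  filter_upwards [hD, hW.continuous h, hZ.continuous, hZ.integrable, hZ.equation] with
    ω hω hWc hZc hint heq t ht
  have hprim : ContinuousOn (fun t : ℝ≥0 => ∫ s in (0 : ℝ)..t, b s (Z s.toNNReal ω)) (Set.Iic T) := by
    refine (intervalIntegral.continuousOn_primitive_interval' hint (by simp)).comp
      NNReal.continuous_coe.continuousOn fun t ht => ?_
    rw [Set.uIcc_of_le T.coe_nonneg]
    exact ⟨t.coe_nonneg, by exact_mod_cast ht⟩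
  have hNc : ContinuousOn (fun t => N t ω) (Set.Iic T) := by
    refine ((hZc.sub continuousOn_const).sub hprim).congr (f := fun t => Z t ω - Z 0 ω -
      ∫ s in (0 : ℝ)..t, b s (Z s.toNNReal ω)) fun t ht => ?_
    simp only [heq t ht]
    abel
  have h1 : Continuous fun t : Set.Iic T => inner ℝ h (N t ω) :=
    continuous_const.inner (continuousOn_iff_continuous_domRestrict.1 hNc)
  have h2 : Continuous fun t : Set.Iic T => c * W h t ω := by fun_prop
  exact congrFun (Continuous.ext_on hDd h1 h2 fun t ht => hω t ht) ⟨t, ht⟩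

/-- The projection of an equation to an eigenvector of the noise, when the drift of the mode is
known before the final time. -/
lemma IsSDESolution.inner_left [BorelSpace H] [SecondCountableTopology H]
    {R : H →L[ℝ] H} {N Z : ℝ≥0 → Ω → H}
    {b : ℝ → H → H} {T : ℝ≥0} (hW : IsWienerOn W P) (hN : IsImageNoise R W N P)
    (hZ : IsSDESolution b N T Z P) {h : H} {c : ℝ} (hR : R h = c • h) {β : ℝ → ℝ → ℝ}
    (hβ : ∀ s : ℝ, 0 < s → s < T → ∀ z, inner ℝ h (b s z) = β s (inner ℝ h z)) :
    IsSDESolution β (fun t ω => c * W h t ω) T (fun t ω => inner ℝ h (Z t ω)) P := by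
  have hdrift : ∀ ω, ∀ s ∈ Set.Ioo (0 : ℝ) T,
      inner ℝ h (b s (Z s.toNNReal ω)) = β s (inner ℝ h (Z s.toNNReal ω)) :=
    fun ω s hs => hβ s hs.1 hs.2 _
  refine ⟨fun t ht => ?_, ?_, ?_, ?_⟩
  · have := hZ.measurable t ht
    fun_prop
  · filter_upwards [hZ.continuous] with ω hω using continuousOn_const.inner hω
  · filter_upwards [hZ.integrable] with ω hω
    have h1 : IntervalIntegrable (fun s => inner ℝ h (b s (Z s.toNNReal ω))) volume 0 (T : ℝ) :=
      ⟨hω.1.const_inner h, hω.2.const_inner h⟩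
    -- The endpoints are null for the integral, so the drift of the mode is not needed at the final
    -- time, where the score degenerates in the application.
    refine h1.congr_uIoo fun s hs => ?_
    rw [Set.uIoo_of_le T.coe_nonneg] at hs
    exact hdrift ω s hs
  · filter_upwards [ae_forall_inner_noise_eq hW hN hZ hR, hZ.integrable, hZ.equation] with
      ω hn hint heq t ht
    have hint' : IntervalIntegrable (fun s => b s (Z s.toNNReal ω)) volume 0 (t : ℝ) := by
      refine hint.mono_set (Set.uIcc_subset_uIcc_left ?_)
      rw [Set.uIcc_of_le T.coe_nonneg]
      exact ⟨t.coe_nonneg, by exact_mod_cast ht⟩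
    have h1 := (innerSL ℝ h).intervalIntegral_comp_comm hint'
    simp only [innerSL_apply_apply] at h1
    rw [← hn t ht, heq t ht, inner_add_right, inner_add_right, ← h1]
    congr 2
    exact intervalIntegral.integral_congr_Ioo_of_le t.coe_nonneg fun s hs =>
      hdrift ω s ⟨hs.1, hs.2.trans_le (by exact_mod_cast ht)⟩

end Modes

/-! ### Scalar coefficients of the regression and the score -/

section Score

variable {n : ℕ} {η : Fin n → ℕ} {lam mu : ℕ → ℝ} {σ : ℝ}

lemma modeQ_apply (k : Fin n) : modeQ η mu σ (η k) = mu (η k) / σ ^ 2 := by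
  simp [modeQ]

lemma modeQ_of_notMem {j : ℕ} (hj : j ∉ Set.range η) : modeQ η mu σ j = 0 := by
  simp [modeQ, hj]

lemma modeQ_nonneg (hmu : ∀ j, 0 < mu j) (j : ℕ) : 0 ≤ modeQ η mu σ j :=
  Set.indicator_nonneg (fun i _ => by have := hmu i; positivity) j

/-- The coefficient of `⟨v_j, x⟩` in the regression function. -/
def regressionX (p q t : ℝ) : ℝ := Real.exp (t / 2) / (1 + (Real.exp t - 1) * p * (1 + q))

/-- The coefficient of `y^{(j)}` in the regression function. -/
def regressionY (p q t : ℝ) : ℝ :=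
  (Real.exp t - 1) * p * q / (1 + (Real.exp t - 1) * p * (1 + q))

variable {p q t : ℝ}

lemma one_le_regression_denominator (hp : 0 ≤ p) (hq : 0 ≤ q) (ht : 0 ≤ t) :
    1 ≤ 1 + (Real.exp t - 1) * p * (1 + q) := by
  have : 0 ≤ Real.exp t - 1 := by simpa using ht
  have : 0 ≤ (Real.exp t - 1) * p * (1 + q) := by positivity
  linarith

lemma abs_regressionX_le (hp : 0 ≤ p) (hq : 0 ≤ q) (ht : 0 ≤ t) :
    |regressionX p q t| ≤ Real.exp (t / 2) := by
  have h := one_le_regression_denominator hp hq ht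
  rw [regressionX, abs_of_nonneg (by positivity)]
  exact div_le_self (Real.exp_pos _).le h

lemma abs_regressionY_le (hp : 0 ≤ p) (hq : 0 ≤ q) (ht : 0 ≤ t) :
    |regressionY p q t| ≤ 1 := by
  have h := one_le_regression_denominator hp hq ht
  have h0 : 0 ≤ Real.exp t - 1 := by simpa using ht
  rw [regressionY, abs_of_nonneg (by positivity), div_le_one (by positivity)]
  have : 0 ≤ (Real.exp t - 1) * p := by positivity
  linarith

/-- This is the weight of the `j`-th coordinate of `X_0` left in the residual; it covers unobserved
modes too, where `q = 0`. -/
lemma one_sub_regression (hp : 0 ≤ p) (hq : 0 ≤ q) (ht : 0 ≤ t) :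
    1 - Real.exp (-t / 2) * regressionX p q t - regressionY p q t =
      (Real.exp t - 1) * p / (1 + (Real.exp t - 1) * p * (1 + q)) := by
  have h := one_le_regression_denominator hp hq ht
  have he : Real.exp (-t / 2) * Real.exp (t / 2) = 1 := by
    rw [← Real.exp_add]; ring_nf; simp
  rw [regressionX, regressionY, mul_div_assoc', he]
  field_simp
  ring

/-- The left side is the factor of `⟨v_j, z⟩` in `z / 2` plus the score; `0 < t` makes `1 - e^{-t}`
invertible. -/
lemma coeffX_eq (hp : 0 ≤ p) (hq : 0 ≤ q) (ht : 0 < t) :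
    1 / 2 - (1 - Real.exp (-t))⁻¹ * (1 - Real.exp (-t / 2) * regressionX p q t) =
      coeffX p q t := by
  have h := one_le_regression_denominator hp hq ht.le
  have he : Real.exp (-t / 2) * Real.exp (t / 2) = 1 := by
    rw [← Real.exp_add]; ring_nf; simp
  have he1 : Real.exp t - 1 ≠ 0 := by simpa [sub_eq_zero] using ht.ne'
  rw [coeffX, regressionX, Real.exp_neg, mul_div_assoc', he]
  field_simp
  ring

lemma coeffY_eq (ht : 0 < t) :
    (1 - Real.exp (-t))⁻¹ * (Real.exp (-t / 2) * regressionY p q t) = coeffY p q t := by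
  have he1 : Real.exp t - 1 ≠ 0 := by simpa [sub_eq_zero] using ht.ne'
  have he : Real.exp (-t / 2) * Real.exp t = Real.exp (t / 2) := by
    rw [← Real.exp_add]; ring_nf
  rw [coeffY, regressionY, Real.exp_neg, ← he]
  field_simp

end Score

/-! ### The observation operator on the basis -/

section Observation

variable {H : Type*} [NormedAddCommGroup H] [InnerProductSpace ℝ H] [CompleteSpace H]
  {v : HilbertBasis ℕ ℝ H} {n : ℕ} {η : Fin n → ℕ} {A : H →L[ℝ] EuclideanSpace ℝ (Fin n)}

omit [CompleteSpace H] in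
lemma apply_of_mem_range (hη : Function.Injective η) (hA : ∀ f k, A f k = inner ℝ (v (η k)) f)
    (k : Fin n) : A (v (η k)) = EuclideanSpace.single k 1 := by
  ext i
  rw [hA]
  by_cases h : i = k
  · simp [h, v.orthonormal.1]
  · simp [v.orthonormal.2 (hη.ne h), h]

omit [CompleteSpace H] in
lemma apply_of_notMem_range (hA : ∀ f k, A f k = inner ℝ (v (η k)) f) {j : ℕ}
    (hj : j ∉ Set.range η) : A (v j) = 0 := by
  ext i
  rw [hA]
  exact v.orthonormal.2 fun h => hj ⟨i, h⟩

lemma adjoint_single (hA : ∀ f k, A f k = inner ℝ (v (η k)) f) (k : Fin n) :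
    A.adjoint (EuclideanSpace.single k 1) = v (η k) := by
  refine ext_inner_right ℝ fun x => ?_
  rw [ContinuousLinearMap.adjoint_inner_left, ← hA, EuclideanSpace.inner_single_left]
  simp

lemma inner_adjoint_eq_modeObs (hη : Function.Injective η)
    (hA : ∀ f k, A f k = inner ℝ (v (η k)) f) (y : EuclideanSpace ℝ (Fin n)) (j : ℕ) :
    inner ℝ (v j) (A.adjoint y) = modeObs η y j := by
  rw [ContinuousLinearMap.adjoint_inner_right]
  by_cases hj : j ∈ Set.range η
  · obtain ⟨k, rfl⟩ := hj
    rw [apply_of_mem_range hη hA, modeObs, hη.extend_apply, EuclideanSpace.inner_single_left]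
    simp
  · rw [apply_of_notMem_range hA hj, modeObs, Function.extend_apply' _ _ _ fun ⟨k, hk⟩ => hj ⟨k, hk⟩]
    simp

end Observation

/-! ### The diagonal regression of the initial value -/

section ConditionalScore

variable {H : Type*} [NormedAddCommGroup H] [InnerProductSpace ℝ H] [CompleteSpace H]
  [SecondCountableTopology H] [MeasurableSpace H] [BorelSpace H]
  {v : HilbertBasis ℕ ℝ H} {lam mu : ℕ → ℝ} {C Cμ R : H →L[ℝ] H} {n : ℕ} {η : Fin n → ℕ}
  {A : H →L[ℝ] EuclideanSpace ℝ (Fin n)} {σ : ℝ} {T : ℝ≥0}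
  {Ω : Type*} [MeasurableSpace Ω] {P : Measure Ω} [IsProbabilityMeasure P]
  {W : H → ℝ≥0 → Ω → ℝ} {N X : ℝ≥0 → Ω → H} {B Y : Ω → EuclideanSpace ℝ (Fin n)}

/-- The regression of `X_0` on `(X_t, Y)` is diagonal in the basis `v`. -/
lemma exists_unique_isRegression_diagonal (hC : C.IsPositive) (hCμ : Cμ.IsPositive)
    (hCv : ∀ j, C (v j) = lam j • v j) (hCμv : ∀ j, Cμ (v j) = mu j • v j)
    (hmu : ∀ j, 0 < mu j) (hR : IsPositiveSqrt R C) (hη : Function.Injective η)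
    (hA : ∀ f k, A f k = inner ℝ (v (η k)) f) (hσ : 0 < σ)
    (hW : IsWienerOn W P) (hN : IsImageNoise R W N P)
    (hX : IsSDESolution (fun _ x => -(1 / 2 : ℝ) • x) N T X P)
    (hX0 : IsGaussianElement (X 0) 0 Cμ P)
    (hB : IsGaussianElement B 0 (σ ^ 2 • ContinuousLinearMap.id ℝ (EuclideanSpace ℝ (Fin n))) P)
    (hXB : IndepFun (X 0) B P)
    (hXBW : IndepFun (fun ω => (X 0 ω, B ω)) (fun ω (p : H × ℝ≥0) => W p.1 p.2 ω) P)
    (hY : ∀ ω, Y ω = A (X 0 ω) + B ω) {t : ℝ≥0} (ht : 0 < t) (htT : t ≤ T) :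
    ∃ m : H × EuclideanSpace ℝ (Fin n) → H, IsRegression P (X 0) (fun ω => (X t ω, Y ω)) m ∧
      (∀ m', IsRegression P (X 0) (fun ω => (X t ω, Y ω)) m' → m' = m) ∧
      ∀ j x y, inner ℝ (v j) (m (x, y)) =
        regressionX (modeP lam mu j) (modeQ η mu σ j) t * inner ℝ (v j) x +
        regressionY (modeP lam mu j) (modeQ η mu σ j) t * modeObs η y j := by
  have ht0 : (0 : ℝ) ≤ t := t.coe_nonneg
  have hlam : ∀ j, 0 ≤ lam j := fun j => by
    have := hC.inner_nonneg_left (v j)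
    rw [hCv, inner_smul_left, real_inner_self_eq_norm_sq, v.orthonormal.1] at this
    simpa using this
  have hp : ∀ j, 0 ≤ modeP lam mu j := fun j => div_nonneg (hlam j) (hmu j).le
  have hq : ∀ j, 0 ≤ modeQ η mu σ j := modeQ_nonneg hmu
  obtain ⟨G, hGs, hGv⟩ := v.exists_isSymmetric_apply_eq_smul
    (fun j => regressionX (modeP lam mu j) (modeQ η mu σ j) t)
    (fun j => abs_regressionX_le (hp j) (hq j) ht0)
  obtain ⟨J, hJs, hJv⟩ := v.exists_isSymmetric_apply_eq_smul
    (fun j => regressionY (modeP lam mu j) (modeQ η mu σ j) t)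
    (fun j => abs_regressionY_le (hp j) (hq j) ht0)
  set e := Real.exp (-t / 2) with he
  set M := fun ω => X t ω - e • X 0 ω with hMdef
  have hM : IsGaussianElement M 0 ((1 - Real.exp (-t)) • C) P :=
    isGaussianElement_ornsteinUhlenbeck hR hW hN hX ht htT
  have hXBm : AEMeasurable (fun ω => (X 0 ω, B ω)) P :=
    (hX0.measurable.prodMk hB.measurable).aemeasurable
  have hXBM : IndepFun (fun ω => (X 0 ω, B ω)) M P :=
    indepFun_ornsteinUhlenbeck hW hN hX ht htT hXBm hXBW
  have hV : (fun ω => (X t ω, Y ω)) = fun ω => (e • X 0 ω + M ω, A (X 0 ω) + B ω) := by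
    ext ω <;> simp [hMdef, hY]
  -- the residual operator is diagonal as well
  have hres : ∀ j, v j - e • G (v j) - A.adjoint (A (J (v j))) =
      ((Real.exp t - 1) * modeP lam mu j /
        (1 + (Real.exp t - 1) * modeP lam mu j * (1 + modeQ η mu σ j))) • v j := fun j => by
    rw [← one_sub_regression (hp j) (hq j) ht0, hGv, hJv, map_smul, map_smul]
    by_cases hj : j ∈ Set.range η
    · obtain ⟨k, rfl⟩ := hj
      rw [apply_of_mem_range hη hA, adjoint_single hA]
      module
    · have h0 : regressionY (modeP lam mu j) (modeQ η mu σ j) t = 0 := by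
        rw [regressionY, modeQ_of_notMem hj]; simp
      rw [apply_of_notMem_range hA hj, h0, map_zero]
      module
  have hlammu : ∀ j, lam j = modeP lam mu j * mu j := fun j =>
    (div_mul_cancel₀ _ (hmu j).ne').symm
  -- On `v j` both normal equations are scalar: this one rests on `λ = p μ` and `e^{-t/2} (e^t - 1)
  -- = (1 - e^{-t}) e^{t/2}`, the next on `μ = σ² q` for observed modes, both sides being zero
  -- otherwise.
  have h₁ : e • Cμ.comp (.id ℝ H - e • G - A.adjoint.comp (A.comp J)) =
      ((1 - Real.exp (-t)) • C).comp G := v.clm_ext fun j => by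
    have h := one_le_regression_denominator (hp j) (hq j) ht0
    have e1 : Real.exp t = Real.exp (t / 2) ^ 2 := by rw [← Real.exp_nat_mul]; ring_nf
    have e2 : e = (Real.exp (t / 2))⁻¹ := by rw [he, ← Real.exp_neg]; ring_nf
    change e • Cμ (v j - e • G (v j) - A.adjoint (A (J (v j)))) =
      (1 - Real.exp (-t)) • C (G (v j))
    rw [hres, hGv, map_smul, map_smul, hCμv, hCv, smul_smul, smul_smul, smul_smul, smul_smul]
    congr 1
    rw [regressionX, hlammu j, Real.exp_neg, e2]
    field_simp
    rw [e1]
  have h₂ : A.comp (Cμ.comp (.id ℝ H - e • G - A.adjoint.comp (A.comp J))) =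
      (σ ^ 2 • ContinuousLinearMap.id ℝ (EuclideanSpace ℝ (Fin n))).comp (A.comp J) :=
    v.clm_ext fun j => by
    change A (Cμ (v j - e • G (v j) - A.adjoint (A (J (v j))))) = σ ^ 2 • A (J (v j))
    rw [hres, hJv, map_smul, map_smul, map_smul, hCμv, map_smul, smul_smul, smul_smul]
    by_cases hj : j ∈ Set.range η
    · obtain ⟨k, rfl⟩ := hj
      congr 1
      have hmuq : mu (η k) = σ ^ 2 * modeQ η mu σ (η k) := by
        rw [modeQ_apply]; field_simp
      rw [regressionY]
      linear_combination ((Real.exp t - 1) * modeP lam mu (η k) /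
        (1 + (Real.exp t - 1) * modeP lam mu (η k) * (1 + modeQ η mu σ (η k)))) * hmuq
    · simp [apply_of_notMem_range hA hj]
  have hreg := isRegression_linearGaussianModel hX0 hB hM hXB hXBM e A hGs hJs
    (fun h => by simpa using congrArg (fun S => S h) h₁)
    (fun h => by simpa using congrArg (fun S => S h) h₂)
  have hsupp := support_map_linearGaussianModel hX0 hB hM hXB hXBM e A (Real.exp_pos _).ne'
    (fun g hg => v.eq_zero_of_inner_apply_self_eq_zero hCμ.isSymmetric hCμv hmu hg)
    (fun z hz => by simpa [inner_smul_left, hσ.ne'] using hz)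
  rw [← hV] at hreg hsupp
  have hVm : Measurable (fun ω => (X t ω, Y ω)) := by
    have h1 := hX.measurable t htT
    have h2 := hX0.measurable
    have h3 := hB.measurable
    simp_rw [hY]
    fun_prop
  refine ⟨_, hreg, fun m' hm' => hm'.eq_of_support_eq_univ hVm hsupp hreg, fun j x y => ?_⟩
  have e1 : inner ℝ (v j) (G x) = inner ℝ (G (v j)) x := (hGs (v j) x).symm
  have e2 : inner ℝ (v j) (J (A.adjoint y)) = inner ℝ (J (v j)) (A.adjoint y) :=
    (hJs (v j) (A.adjoint y)).symm
  rw [inner_add_right, e1, e2, hGv, hJv, inner_smul_left, inner_smul_left,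
    inner_adjoint_eq_modeObs hη hA]
  simp

end ConditionalScore

end

/-! ### The reverse equation in modes -/

theorem lemma2
    {H : Type*} [NormedAddCommGroup H] [InnerProductSpace ℝ H] [CompleteSpace H]
    [TopologicalSpace.SeparableSpace H] [MeasurableSpace H] [BorelSpace H]
    -- the covariance operators `C` and `Cμ` and their common orthonormal basis of eigenvectors
    (v : HilbertBasis ℕ ℝ H) (lam mu : ℕ → ℝ)
    (C Cμ sqrtC : H →L[ℝ] H)
    (hC : C.IsPositive) (hCμ : Cμ.IsPositive)
    (hCv : ∀ j, C (v j) = lam j • v j) (hCμv : ∀ j, Cμ (v j) = mu j • v j)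
    (hmu : ∀ j, 0 < mu j) (hlam_sum : Summable lam) (hmu_sum : Summable mu)
    (hsqrt : IsPositiveSqrt sqrtC C)
    -- the observation operator
    (n : ℕ) (η : Fin n → ℕ) (hη : Function.Injective η)
    (A : H →L[ℝ] EuclideanSpace ℝ (Fin n)) (hA : ∀ f k, A f k = inner ℝ (v (η k)) f)
    (σ : ℝ) (hσ : 0 < σ) (T : ℝ≥0) (hT : 0 < T)
    -- the forward process, the noise and the observation
    {Ω : Type*} [MeasurableSpace Ω] (P : Measure Ω) [IsProbabilityMeasure P]
    (W : H → ℝ≥0 → Ω → ℝ) (hW : IsWienerOn W P)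
    (N : ℝ≥0 → Ω → H) (hN : IsImageNoise sqrtC W N P)
    (X : ℝ≥0 → Ω → H)
    (hX : IsSDESolution (fun _ x => -(1 / 2 : ℝ) • x) N T X P)
    (hX0 : IsGaussianElement (X 0) 0 Cμ P)
    (B : Ω → EuclideanSpace ℝ (Fin n))
    (hB : IsGaussianElement B 0 (σ ^ 2 • ContinuousLinearMap.id ℝ (EuclideanSpace ℝ (Fin n))) P)
    (hXB : IndepFun (X 0) B P)
    (hXBW : IndepFun (fun ω => (X 0 ω, B ω)) (fun ω (p : H × ℝ≥0) => W p.1 p.2 ω) P)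
    (Y : Ω → EuclideanSpace ℝ (Fin n)) (hY : ∀ ω, Y ω = A (X 0 ω) + B ω)
    -- the reverse process, for the observed value `y`
    (y : EuclideanSpace ℝ (Fin n))
    {Ω' : Type*} [MeasurableSpace Ω'] (P' : Measure Ω') [IsProbabilityMeasure P']
    (W' : H → ℝ≥0 → Ω' → ℝ) (hW' : IsWienerOn W' P')
    (N' : ℝ≥0 → Ω' → H) (hN' : IsImageNoise sqrtC W' N' P')
    (Z : ℝ≥0 → Ω' → H)
    (hZ : IsSDESolution (fun s z => (1 / 2 : ℝ) • z + condScore P X Y ((T : ℝ) - s) z y)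
      N' T Z P') :
    -- the conditional expectation in the score has exactly one continuous version
    (∀ t : ℝ≥0, 0 < t → t ≤ T →
      ∃! m : H × EuclideanSpace ℝ (Fin n) → H,
        IsRegression P (X 0) (fun ω => (X t ω, Y ω)) m) ∧
    -- the processes `W^{(j)}` are independent standard Brownian motions
    (∀ j, IsBrownianReal (W' (v j)) P') ∧
    iIndepFun (fun (j : ℕ) (ω : Ω') (t : ℝ≥0) => W' (v j) t ω) P' ∧
    -- the equations of the modes
    (∀ j, IsSDESolution
      (fun s z =>
        coeffX (modeP lam mu j) (modeQ η mu σ j) ((T : ℝ) - s) * z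
          + coeffY (modeP lam mu j) (modeQ η mu σ j) ((T : ℝ) - s) * modeObs η y j)
      (fun t ω => Real.sqrt (lam j) * W' (v j) t ω) T
      (fun t ω => inner ℝ (v j) (Z t ω)) P') := by
  have : SecondCountableTopology H := UniformSpace.secondCountable_of_separable H
  have hex := fun (t : ℝ≥0) (ht : 0 < t) (htT : t ≤ T) => exists_unique_isRegression_diagonal
    hC hCμ hCv hCμv hmu hsqrt hη hA hσ hW hN hX hX0 hB hXB hXBW hY ht htT
  have hlam : ∀ j, 0 ≤ lam j := fun j => by
    have := hC.inner_nonneg_left (v j)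
    rw [hCv, inner_smul_left, real_inner_self_eq_norm_sq, v.orthonormal.1] at this
    simpa using this
  refine ⟨fun t ht htT => ?_, fun j => hW'.isBrownianReal (v.orthonormal.1 j),
    hW'.iIndepFun_of_orthonormal v.orthonormal, fun j => ?_⟩
  · obtain ⟨m, hm, huniq, -⟩ := hex t ht htT
    exact ⟨m, hm, huniq⟩
  · refine hZ.inner_left hW' hN' (hsqrt.apply_eigenvector (hlam j) (hCv j))
      (β := fun s z => coeffX (modeP lam mu j) (modeQ η mu σ j) ((T : ℝ) - s) * z
        + coeffY (modeP lam mu j) (modeQ η mu σ j) ((T : ℝ) - s) * modeObs η y j)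
      fun s hs hsT z => ?_
    have hp : 0 ≤ modeP lam mu j := div_nonneg (hlam j) (hmu j).le
    have hpos : 0 < (T : ℝ) - s := sub_pos.2 hsT
    have ht' : ((T : ℝ) - s).toNNReal ≤ T := by
      rw [Real.toNNReal_le_iff_le_coe]; linarith
    -- The score at reverse time `s` uses the regression at forward time `T - s`, which is positive
    -- since `s < T`.
    obtain ⟨m, hm, huniq, hmodes⟩ := hex _ (Real.toNNReal_pos.2 hpos) ht'
    rw [condScore, regression_eq_of_unique hm huniq, inner_add_right, inner_smul_right,
      inner_smul_right, inner_sub_right, inner_smul_right, hmodes, Real.coe_toNNReal _ hpos.le,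
      ← coeffX_eq hp (modeQ_nonneg hmu j) hpos, ← coeffY_eq hpos]
    ring
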